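/- Let $A\in\mathbb R^{2\times 2}$, $b,c\in\mathbb R^2$, and let $\delta_{\min},\delta_{\max}:[0,1]\to\mathbb R$ be continuous with $\delta_{\min}\le 0\le\delta_{\max}$. Call a continuously differentiable function $\kappa:[0,\infty)\to[0,1]$ an admissible gain if $\delta_{\min}(\kappa(t))\le\dot\kappa(t)\le\delta_{\max}(\kappa(t))$ for all $t\ge 0$. The system $$\dot x=Ax+bu,\qquad y=c^{T}x,\qquad u=\kappa(t)\,y$$ is called absolutely stable if, for every admissible gain $\kappa$, its zero solution is globally asymptotically stable. With $\mathbf i(\theta)=(\cos\theta,\sin\theta)^T$ and $\mathbf j(\theta)=(-\sin\theta,\cos\theta)^T$ put $$h(\kappa,\theta)=\mathbf i(\theta)^T(A+\kappa bc^T)\mathbf i(\theta),\qquad g(\kappa,\theta)=\mathbf j(\theta)^T(A+\kappa bc^T)\mathbf i(\theta),\qquad f=h/g,$$ and assume that the closed loop oscillates counterclockwise for every constant gain, i.e. $g(\kappa,\theta)>0$ for all $\kappa\in[0,1]$ and all $\theta$. Let $\rho:[0,1]\times[0,\infty)\to\mathbb R$, $(\kappa,\theta)\mapsto\rho(\kappa,\theta)$,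 be continuous, a viscosity solution in $(0,1)\times(0,\infty)$ of the Hamilton–Jacobi–Bellman equation $$\rho_\theta+\frac{1}{g(\kappa,\theta)}\,\min_{\delta_{\min}(\kappa)\le\nu\le\delta_{\max}(\kappa)}\{\nu\,\rho_\kappa\}=f(\kappa,\theta)\,\rho ,$$ and such that $\rho(\kappa,0)=1$ for all $\kappa\in[0,1]$. (Viscosity solution: whenever a $C^1$ function $\varphi$ touches $\rho$ from below, respectively from above, at an interior point, the equation holds at that point with $\ge$, respectively $\le$, in place of $=$ and with $\varphi_\theta,\varphi_\kappa$ in place of $\rho_\theta,\rho_\kappa$.) Suppose in addition that $\delta_{\min},\delta_{\max}$ are Lipschitz on $[0,1]$ or that $\rho$ is locally Lipschitz. If there is $N\in\mathbb N$ such that $\rho(\kappa,N\pi)<1$ for all $\kappa\in[0,1]$, then the system is absolutely stable. -/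

import Mathlib

open Set Filter Topology Matrix

noncomputable section

namespace GainFeedback

/-- The pair of rate bounds: continuous on `[0, 1]` with `δmin ≤ 0 ≤ δmax` there. -/
structure IsRateBound (δmin δmax : ℝ → ℝ) : Prop where
  continuousOn_min : ContinuousOn δmin (Icc 0 1)
  continuousOn_max : ContinuousOn δmax (Icc 0 1)
  min_nonpos : ∀ k ∈ Icc (0 : ℝ) 1, δmin k ≤ 0
  max_nonneg : ∀ k ∈ Icc (0 : ℝ) 1, 0 ≤ δmax k

/-- Admissible feedback gains: continuously differentiable functions of `t ≥ 0` with values in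
`[0, 1]` whose rate of change obeys the gain-dependent bounds. -/
structure IsAdmissibleGain (δmin δmax : ℝ → ℝ) (κ : ℝ → ℝ) : Prop where
  contDiffOn : ContDiffOn ℝ 1 κ (Ici 0)
  mem_Icc : ∀ t, 0 ≤ t → κ t ∈ Icc (0 : ℝ) 1
  rate_mem : ∀ t, 0 ≤ t → derivWithin κ (Ici 0) t ∈ Icc (δmin (κ t)) (δmax (κ t))

/-- `x` solves, on `[t₀, ∞)`, the plant `x' = A x + b u`, `y = cᵀ x` closed by `u = κ(t) y`. -/
def IsClosedLoopSolution (A : Matrix (Fin 2) (Fin 2) ℝ) (b c : Fin 2 → ℝ) (κ : ℝ → ℝ)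
    (t₀ : ℝ) (x : ℝ → Fin 2 → ℝ) : Prop :=
  ∀ t, t₀ ≤ t → HasDerivWithinAt x (A *ᵥ x t + (κ t * (c ⬝ᵥ x t)) • b) (Ici t₀) t

/-- Global asymptotic stability of the zero solution for a fixed gain: Lyapunov stability from
every initial time, and attraction of all solutions. (The choice of norm on `ℝ²` is immaterial.) -/
structure IsGloballyAsymptoticallyStable (A : Matrix (Fin 2) (Fin 2) ℝ) (b c : Fin 2 → ℝ)
    (κ : ℝ → ℝ) : Prop where
  stable : ∀ t₀, 0 ≤ t₀ → ∀ ε > 0, ∃ d > 0, ∀ x : ℝ → Fin 2 → ℝ,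
    IsClosedLoopSolution A b c κ t₀ x → ‖x t₀‖ < d → ∀ t, t₀ ≤ t → ‖x t‖ < ε
  attractive : ∀ t₀, 0 ≤ t₀ → ∀ x : ℝ → Fin 2 → ℝ,
    IsClosedLoopSolution A b c κ t₀ x → Tendsto x atTop (𝓝 0)

/-- Absolute stability: the zero solution is globally asymptotically stable under every
admissible gain. -/
def IsAbsolutelyStable (A : Matrix (Fin 2) (Fin 2) ℝ) (b c : Fin 2 → ℝ)
    (δmin δmax : ℝ → ℝ) : Prop :=
  ∀ κ : ℝ → ℝ, IsAdmissibleGain δmin δmax κ → IsGloballyAsymptoticallyStable A b c κ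

/-- The radial unit vector. -/
def radial (θ : ℝ) : Fin 2 → ℝ := ![Real.cos θ, Real.sin θ]

/-- The angular unit vector. -/
def angular (θ : ℝ) : Fin 2 → ℝ := ![-Real.sin θ, Real.cos θ]

/-- The closed-loop matrix `A + k b cᵀ` for the frozen gain `k`. -/
def closedLoopMatrix (A : Matrix (Fin 2) (Fin 2) ℝ) (b c : Fin 2 → ℝ) (k : ℝ) :
    Matrix (Fin 2) (Fin 2) ℝ :=
  A + k • vecMulVec b c

/-- The radial rate: in polar coordinates `r' = h(k, θ) r` with respect to time. -/
def h (A : Matrix (Fin 2) (Fin 2) ℝ) (b c : Fin 2 → ℝ) (k θ : ℝ) : ℝ :=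
  radial θ ⬝ᵥ (closedLoopMatrix A b c k *ᵥ radial θ)

/-- The angular rate: in polar coordinates `θ' = g(k, θ)` with respect to time. -/
def g (A : Matrix (Fin 2) (Fin 2) ℝ) (b c : Fin 2 → ℝ) (k θ : ℝ) : ℝ :=
  angular θ ⬝ᵥ (closedLoopMatrix A b c k *ᵥ radial θ)

/-- The radial rate with respect to the angle: `dr/dθ = f(k, θ) r`. -/
def f (A : Matrix (Fin 2) (Fin 2) ℝ) (b c : Fin 2 → ℝ) (k θ : ℝ) : ℝ :=
  h A b c k θ / g A b c k θ

/-- For every gain in `[0, 1]` the closed loop turns counterclockwise at every angle. -/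
def OscillatesCounterclockwise (A : Matrix (Fin 2) (Fin 2) ℝ) (b c : Fin 2 → ℝ) : Prop :=
  ∀ k ∈ Icc (0 : ℝ) 1, ∀ θ : ℝ, 0 < g A b c k θ

/-- The closed half-strip of points `(k, θ)` with `0 ≤ k ≤ 1` and `θ ≥ 0`. -/
def halfStrip : Set (ℝ × ℝ) := Icc 0 1 ×ˢ Ici 0

/-- The minimum of `ν p` over the admissible rates `ν ∈ [δmin(k), δmax(k)]`. -/
def minRate (δmin δmax : ℝ → ℝ) (k p : ℝ) : ℝ :=
  sInf ((fun ν : ℝ => ν * p) '' Icc (δmin k) (δmax k))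

/-- The left-hand side minus the right-hand side of the Hamilton–Jacobi–Bellman equation
`ρ_θ + min_ν (ν ρ_k) / g = f ρ` at the point `(k, θ)`, where `z`, `p`, `q` stand for the values of
`ρ`, `ρ_k`, `ρ_θ`. The coefficient `1 / g` comes from `dk/dθ = (dk/dt) / (dθ/dt) = ν / g`. -/
def hjb (A : Matrix (Fin 2) (Fin 2) ℝ) (b c : Fin 2 → ℝ) (δmin δmax : ℝ → ℝ)
    (k θ z p q : ℝ) : ℝ :=
  q + minRate δmin δmax k p / g A b c k θ - f A b c k θ * z

/-- `ρ` is a continuous viscosity solution of the Hamilton–Jacobi–Bellman equation. The equation is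
imposed, through test functions touching from below and from above, at the interior points of the
half-strip; on the sides `k = 0` and `k = 1` nothing but continuity is required. -/
structure IsViscositySolution (A : Matrix (Fin 2) (Fin 2) ℝ) (b c : Fin 2 → ℝ)
    (δmin δmax : ℝ → ℝ) (ρ : ℝ × ℝ → ℝ) : Prop where
  continuousOn : ContinuousOn ρ halfStrip
  supersolution : ∀ k ∈ Ioo (0 : ℝ) 1, ∀ θ ∈ Ioi (0 : ℝ), ∀ φ : ℝ × ℝ → ℝ,
    ContDiffAt ℝ 1 φ (k, θ) → φ (k, θ) = ρ (k, θ) → (∀ᶠ q in 𝓝 (k, θ), φ q ≤ ρ q) →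
    0 ≤ hjb A b c δmin δmax k θ (ρ (k, θ))
      (deriv (fun s => φ (s, θ)) k) (deriv (fun s => φ (k, s)) θ)
  subsolution : ∀ k ∈ Ioo (0 : ℝ) 1, ∀ θ ∈ Ioi (0 : ℝ), ∀ φ : ℝ × ℝ → ℝ,
    ContDiffAt ℝ 1 φ (k, θ) → φ (k, θ) = ρ (k, θ) → (∀ᶠ q in 𝓝 (k, θ), ρ q ≤ φ q) →
    hjb A b c δmin δmax k θ (ρ (k, θ))
      (deriv (fun s => φ (s, θ)) k) (deriv (fun s => φ (k, s)) θ) ≤ 0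

/-- The standard regularity for comparing viscosity solutions: either the rate bounds are Lipschitz
on `[0, 1]`, or the solution is locally Lipschitz. -/
def HasLipschitzRegularity (δmin δmax : ℝ → ℝ) (ρ : ℝ × ℝ → ℝ) : Prop :=
  ((∃ K, LipschitzOnWith K δmin (Icc 0 1)) ∧ (∃ K, LipschitzOnWith K δmax (Icc 0 1))) ∨
    LocallyLipschitzOn halfStrip ρ

end GainFeedback

end

/-! Write a nonzero solution in polar coordinates and use the angle as independent variable. The
gain $K$ then satisfies $K'=\nu/g$ with an admissible rate $\nu$, and the radius satisfies
$R'=f(K,\theta)R$. If $\rho$ were smooth, the derivative of $\rho(K(\theta),\theta)/R(\theta)$ would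
be $(\rho_\theta+K'\rho_\kappa-f\rho)/R\ge 0$, because the equation holds with the minimum over
$\nu$. Hence $1/R(0)\le\rho(K(N\pi),N\pi)/R(N\pi)$. With $q<1$ a positive bound of
$\rho(\cdot,N\pi)$, the radius shrinks by the factor $q$ over $N$ half-turns. Since $g$ and $h$ are
$\pi$-periodic in the angle, this can be repeated from every multiple of $\pi$. As $g$ is bounded
below, decay in the angle is exponential decay in time, uniformly in the gain.

The work lies in the monotonicity for a viscosity solution (`quotient_zero_le`): the trajectory may
run along a side $\kappa=0$ or $\kappa=1$, where no equation is available. It is therefore replaced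
by a thin moving band on one side of it, inside the open strip. If the quotient decreased, then
quotient + squared distance to the band divided by a small number + a growing exponential in
$\theta$ would have an interior minimum. There the supersolution inequality forces a band edge to
move towards the minimizer strictly faster than the dynamics allow (`exists_edge_violation`). For
Lipschitz rate bounds, edges that contract exponentially contradict this. For locally Lipschitz
$\rho$, the slope of the penalty is bounded and parallel edges suffice (`quotient_le_of_side`). -/

noncomputable section

namespace GainFeedback

variable {A : Matrix (Fin 2) (Fin 2) ℝ} {b c : Fin 2 → ℝ} {δmin δmax : ℝ → ℝ}
  {ρ : ℝ × ℝ → ℝ} {K R κ : ℝ → ℝ} {t₀ : ℝ} {x : ℝ → Fin 2 → ℝ}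

/-! ### Angular and radial rates: periodicity and uniform bounds. -/

lemma g_eq (A : Matrix (Fin 2) (Fin 2) ℝ) (b c : Fin 2 → ℝ) (k θ : ℝ) :
    g A b c k θ =
      -Real.sin θ * ((A 0 0 + k * (b 0 * c 0)) * Real.cos θ
        + (A 0 1 + k * (b 0 * c 1)) * Real.sin θ)
      + Real.cos θ * ((A 1 0 + k * (b 1 * c 0)) * Real.cos θ
        + (A 1 1 + k * (b 1 * c 1)) * Real.sin θ) := by
  simp [g, closedLoopMatrix, angular, radial, Matrix.mulVec, dotProduct, Fin.sum_univ_two,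
    vecMulVec]

lemma h_eq (A : Matrix (Fin 2) (Fin 2) ℝ) (b c : Fin 2 → ℝ) (k θ : ℝ) :
    h A b c k θ =
      Real.cos θ * ((A 0 0 + k * (b 0 * c 0)) * Real.cos θ
        + (A 0 1 + k * (b 0 * c 1)) * Real.sin θ)
      + Real.sin θ * ((A 1 0 + k * (b 1 * c 0)) * Real.cos θ
        + (A 1 1 + k * (b 1 * c 1)) * Real.sin θ) := by
  simp [h, closedLoopMatrix, radial, Matrix.mulVec, dotProduct, Fin.sum_univ_two,
    vecMulVec]

lemma continuous_g : Continuous fun q : ℝ × ℝ => g A b c q.1 q.2 := by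
  simp only [g_eq]; fun_prop

lemma continuous_h : Continuous fun q : ℝ × ℝ => h A b c q.1 q.2 := by
  simp only [h_eq]; fun_prop

lemma g_add_pi (k θ : ℝ) : g A b c k (θ + Real.pi) = g A b c k θ := by
  simp only [g_eq, Real.sin_add_pi, Real.cos_add_pi]; ring

lemma h_add_pi (k θ : ℝ) : h A b c k (θ + Real.pi) = h A b c k θ := by
  simp only [h_eq, Real.sin_add_pi, Real.cos_add_pi]; ring

lemma g_add_nat_mul_pi (k θ : ℝ) (n : ℕ) :
    g A b c k (θ + n * Real.pi) = g A b c k θ :=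
  Function.Periodic.nat_mul (f := fun θ => g A b c k θ) (fun θ => g_add_pi k θ) n θ

lemma h_add_nat_mul_pi (k θ : ℝ) (n : ℕ) :
    h A b c k (θ + n * Real.pi) = h A b c k θ :=
  Function.Periodic.nat_mul (f := fun θ => h A b c k θ) (fun θ => h_add_pi k θ) n θ

lemma continuousOn_f (hosc : OscillatesCounterclockwise A b c) :
    ContinuousOn (fun q : ℝ × ℝ => f A b c q.1 q.2) (Icc 0 1 ×ˢ univ) :=
  continuous_h.continuousOn.div continuous_g.continuousOn fun q hq => (hosc q.1 hq.1 q.2).ne'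

lemma exists_pos_le_g (hosc : OscillatesCounterclockwise A b c) :
    ∃ m > 0, ∀ k ∈ Icc (0 : ℝ) 1, ∀ θ, m ≤ g A b c k θ := by
  obtain ⟨q, hq, hmin⟩ := ((isCompact_Icc (a := (0 : ℝ)) (b := 1)).prod
    (isCompact_Icc (a := (0 : ℝ)) (b := Real.pi))).exists_isMinOn
    ⟨(0, 0), by simp [Real.pi_pos.le]⟩ (continuous_g (A := A) (b := b) (c := c)).continuousOn
  refine ⟨_, hosc q.1 hq.1 q.2, fun k hk θ => ?_⟩
  obtain ⟨y, hy, hyθ⟩ := Function.Periodic.exists_mem_Ico₀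
    (f := fun θ => g A b c k θ) (fun θ => g_add_pi k θ) Real.pi_pos θ
  rw [hyθ]
  exact hmin (a := (k, y)) ⟨hk, Ico_subset_Icc_self hy⟩

lemma exists_abs_h_le (A : Matrix (Fin 2) (Fin 2) ℝ) (b c : Fin 2 → ℝ) :
    ∃ H > 0, ∀ k ∈ Icc (0 : ℝ) 1, ∀ θ, |h A b c k θ| ≤ H := by
  obtain ⟨C, hC⟩ := ((isCompact_Icc (a := (0 : ℝ)) (b := 1)).prod
    (isCompact_Icc (a := (0 : ℝ)) (b := Real.pi))).exists_bound_of_continuousOn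
    (continuous_h (A := A) (b := b) (c := c)).continuousOn
  refine ⟨max C 1, by positivity, fun k hk θ => ?_⟩
  obtain ⟨y, hy, hyθ⟩ := Function.Periodic.exists_mem_Ico₀
    (f := fun θ => h A b c k θ) (fun θ => h_add_pi k θ) Real.pi_pos θ
  rw [hyθ]
  exact (hC (k, y) ⟨hk, Ico_subset_Icc_self hy⟩).trans (le_max_left _ _)

/-- The angular rate is affine in the gain, with slope $(\mathbf j^Tb)(c^T\mathbf i)$, which is
bounded uniformly in the angle. -/
lemma exists_abs_g_sub_le (A : Matrix (Fin 2) (Fin 2) ℝ) (b c : Fin 2 → ℝ) :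
    ∃ G, 0 ≤ G ∧ ∀ k k' θ, |g A b c k θ - g A b c k' θ| ≤ G * |k - k'| := by
  refine ⟨(|b 0| + |b 1|) * (|c 0| + |c 1|), by positivity, fun k k' θ => ?_⟩
  have h1 : g A b c k θ - g A b c k' θ =
      (-Real.sin θ * b 0 + Real.cos θ * b 1) * (c 0 * Real.cos θ + c 1 * Real.sin θ)
        * (k - k') := by
    simp only [g_eq]; ring
  have bound (x y u v : ℝ) (hx : |x| ≤ 1) (hy : |y| ≤ 1) : |x * u + y * v| ≤ |u| + |v| := by
    refine (abs_add_le _ _).trans ?_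
    rw [abs_mul, abs_mul]
    gcongr
    · exact mul_le_of_le_one_left (abs_nonneg _) hx
    · exact mul_le_of_le_one_left (abs_nonneg _) hy
  rw [h1, abs_mul, abs_mul]
  gcongr
  · exact bound _ _ _ _ (by rw [abs_neg]; exact Real.abs_sin_le_one θ) (Real.abs_cos_le_one θ)
  · rw [mul_comm (c 0), mul_comm (c 1)]
    exact bound _ _ _ _ (Real.abs_cos_le_one θ) (Real.abs_sin_le_one θ)

/-- Dividing a Lipschitz rate bound by the angular rate leaves it Lipschitz in the gain. -/
lemma exists_abs_div_g_sub_le (hosc : OscillatesCounterclockwise A b c) {δ : ℝ → ℝ}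
    (hδ : ∃ K, LipschitzOnWith K δ (Icc 0 1)) :
    ∃ C > 0, ∀ k ∈ Icc (0 : ℝ) 1, ∀ k' ∈ Icc (0 : ℝ) 1, ∀ θ,
      |δ k / g A b c k θ - δ k' / g A b c k' θ| ≤ C * |k - k'| := by
  obtain ⟨K, hK⟩ := hδ
  obtain ⟨m, hm, hg⟩ := exists_pos_le_g hosc
  obtain ⟨G, hG, hGg⟩ := exists_abs_g_sub_le A b c
  obtain ⟨D, hD⟩ := isCompact_Icc.exists_bound_of_continuousOn hK.continuousOn
  have hD0 : 0 ≤ D := (norm_nonneg _).trans (hD 0 (by simp))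
  refine ⟨K / m + D * G / (m * m) + 1, by positivity, fun k hk k' hk' θ => ?_⟩
  have h1 := hg k hk θ
  have h2 := hg k' hk' θ
  have h3 := hK.dist_le_mul k hk k' hk'
  rw [Real.dist_eq, Real.dist_eq] at h3
  have h4 : δ k / g A b c k θ - δ k' / g A b c k' θ =
      (δ k - δ k') / g A b c k θ
        + δ k' * (g A b c k' θ - g A b c k θ) / (g A b c k θ * g A b c k' θ) := by
    have := hm.trans_le h1
    have := hm.trans_le h2
    field_simp
    ring
  have h5 : |(δ k - δ k') / g A b c k θ| ≤ K * |k - k'| / m := by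
    rw [abs_div, abs_of_pos (hm.trans_le h1)]
    gcongr
  have h6 : |δ k' * (g A b c k' θ - g A b c k θ) / (g A b c k θ * g A b c k' θ)|
      ≤ D * (G * |k - k'|) / (m * m) := by
    have := hm.trans_le h1
    rw [abs_div, abs_mul, abs_of_pos (mul_pos (hm.trans_le h1) (hm.trans_le h2))]
    gcongr
    · exact hD k' hk'
    · rw [abs_sub_comm k]; exact hGg _ _ _
  rw [h4]
  refine (abs_add_le _ _).trans ((add_le_add h5 h6).trans ?_)
  have : 0 ≤ |k - k'| := abs_nonneg _
  have e : (K / m + D * G / (m * m) + 1) * |k - k'|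
    = K * |k - k'| / m + D * (G * |k - k'|) / (m * m) + |k - k'| := by ring
  linarith

/-! ### Trajectories over the angle and the quotient of $\rho$ by the radius. -/

/-- A trajectory of the closed loop in polar coordinates, parametrized by the angle: `K` is the gain
and `R` the radius. -/
structure IsAngularTrajectory (A : Matrix (Fin 2) (Fin 2) ℝ) (b c : Fin 2 → ℝ)
    (δmin δmax : ℝ → ℝ) (K R : ℝ → ℝ) : Prop where
  continuousOn_gain : ContinuousOn K (Ici 0)
  continuousOn_radius : ContinuousOn R (Ici 0)
  gain_mem : ∀ θ, 0 ≤ θ → K θ ∈ Icc (0 : ℝ) 1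
  radius_pos : ∀ θ, 0 ≤ θ → 0 < R θ
  contDiffOn_gain : ContDiffOn ℝ 1 K (Ioi 0)
  contDiffOn_radius : ContDiffOn ℝ 1 R (Ioi 0)
  deriv_gain_mem : ∀ θ, 0 < θ →
    deriv K θ ∈ Icc (δmin (K θ) / g A b c (K θ) θ) (δmax (K θ) / g A b c (K θ) θ)
  hasDerivAt_radius : ∀ θ, 0 < θ → HasDerivAt R (f A b c (K θ) θ * R θ) θ

lemma minRate_le {k p ν : ℝ} (hν : ν ∈ Icc (δmin k) (δmax k)) :
    minRate δmin δmax k p ≤ ν * p :=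
  csInf_le (isCompact_Icc.image (by fun_prop)).bddBelow ⟨ν, hν, rfl⟩

/-- The supersolution inequality for the quotient of `ρ` by the radius of a trajectory. -/
lemma IsViscositySolution.quotient_ineq (hosc : OscillatesCounterclockwise A b c)
    (hρ : IsViscositySolution A b c δmin δmax ρ)
    (hK : IsAngularTrajectory A b c δmin δmax K R) {k θ : ℝ} (hk : k ∈ Ioo (0 : ℝ) 1)
    (hθ : 0 < θ) {ψ : ℝ × ℝ → ℝ} (hψ : ContDiffAt ℝ 1 ψ (k, θ))
    (heq : ψ (k, θ) = ρ (k, θ) / R θ) (hle : ∀ᶠ q in 𝓝 (k, θ), ψ q ≤ ρ q / R q.2)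
    {ψk ψθ : ℝ} (hψk : HasDerivAt (fun s => ψ (s, θ)) ψk k)
    (hψθ : HasDerivAt (fun s => ψ (k, s)) ψθ θ) {ν : ℝ} (hν : ν ∈ Icc (δmin k) (δmax k)) :
    0 ≤ ψθ + ν / g A b c k θ * ψk
      + (f A b c (K θ) θ - f A b c k θ) * (ρ (k, θ) / R θ) := by
  have hR : 0 < R θ := hK.radius_pos θ hθ.le
  have hg : 0 < g A b c k θ := hosc k (Ioo_subset_Icc_self hk) θ
  have hRC : ContDiffAt ℝ 1 (fun q : ℝ × ℝ => R q.2) (k, θ) :=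
    ContDiffAt.comp (k, θ) (g := R) (f := Prod.snd)
      (hK.contDiffOn_radius.contDiffAt (Ioi_mem_nhds hθ)) contDiffAt_snd
  -- Since $R>0$, $R\psi$ touches $\rho$ from below when $\psi$ touches $\rho/R$. The product rule
  -- contributes $R'\psi=f(K,\theta)R\psi$, so only a difference of values of $f$ remains, small
  -- when $k$ is near $K$.
  have key := hρ.supersolution k hk θ hθ (fun q => R q.2 * ψ q) (hRC.mul hψ)
    (by simp only [heq]; field_simp)
    (by
      have hpos : ∀ᶠ q : ℝ × ℝ in 𝓝 (k, θ), 0 < q.2 :=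
        continuous_snd.continuousAt.eventually (Ioi_mem_nhds hθ)
      filter_upwards [hle, hpos] with q hq h0
      have := hK.radius_pos q.2 h0.le
      rwa [le_div_iff₀' this] at hq)
  have d1 : deriv (fun s => R θ * ψ (s, θ)) k = R θ * ψk := (hψk.const_mul _).deriv
  have d2 : deriv (fun s => R s * ψ (k, s)) θ
      = f A b c (K θ) θ * R θ * ψ (k, θ) + R θ * ψθ :=
    ((hK.hasDerivAt_radius θ hθ).mul hψθ).deriv
  simp only [hjb, d1, d2, heq] at key
  have h1 := div_le_div_of_nonneg_right
    (minRate_le (p := R θ * ψk) hν) hg.le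
  have h2 : 0 ≤ R θ * (ψθ + ν / g A b c k θ * ψk
      + (f A b c (K θ) θ - f A b c k θ) * (ρ (k, θ) / R θ)) := by
    have e : R θ * (ψθ + ν / g A b c k θ * ψk
        + (f A b c (K θ) θ - f A b c k θ) * (ρ (k, θ) / R θ))
        = f A b c (K θ) θ * R θ * (ρ (k, θ) / R θ) + R θ * ψθ
          + ν * (R θ * ψk) / g A b c k θ - f A b c k θ * ρ (k, θ) := by
      field_simp
      ring
    rw [e]
    linarith
  exact nonneg_of_mul_nonneg_right h2 hR

/-! ### The penalty: squared distance to a band. -/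

lemma hasDerivAt_posPart_sq (x : ℝ) :
    HasDerivAt (fun s : ℝ => max s 0 ^ 2) (2 * max x 0) x := by
  rcases lt_trichotomy x 0 with hx | rfl | hx
  · have : (fun s : ℝ => max s 0 ^ 2) =ᶠ[𝓝 x] fun _ => 0 := by
      filter_upwards [Iio_mem_nhds hx] with s hs
      rw [max_eq_right (show s ≤ 0 from le_of_lt hs)]; norm_num
    rw [max_eq_right hx.le, mul_zero]
    exact (hasDerivAt_const x (0 : ℝ)).congr_of_eventuallyEq this
  · rw [hasDerivAt_iff_isLittleO_nhds_zero]
    simp only [max_self, mul_zero, zero_add, smul_zero, sub_zero, ne_eq, OfNat.ofNat_ne_zero,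
      not_false_eq_true, zero_pow]
    refine Asymptotics.IsBigO.trans_isLittleO (g := fun s : ℝ => s ^ 2) ?_ ?_
    · refine Asymptotics.IsBigO.of_bound 1 (Eventually.of_forall fun s => ?_)
      rw [one_mul, norm_pow, norm_pow, Real.norm_eq_abs, Real.norm_eq_abs]
      have h0 : 0 ≤ max s 0 := le_max_right _ _
      rw [abs_of_nonneg h0]
      exact pow_le_pow_left₀ h0 (max_le (le_abs_self s) (abs_nonneg s)) 2
    · simpa using Asymptotics.isLittleO_pow_id (𝕜 := ℝ) (n := 2) one_lt_two
  · have : (fun s : ℝ => max s 0 ^ 2) =ᶠ[𝓝 x] fun s => s ^ 2 := by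
      filter_upwards [Ioi_mem_nhds hx] with s hs
      rw [max_eq_left (show 0 ≤ s from le_of_lt hs)]
    rw [max_eq_left hx.le]
    simpa using (hasDerivAt_pow 2 x).congr_of_eventuallyEq this

/-- Squaring removes the kink of the positive part, which makes the penalty eligible as a $C^1$ test
function. -/
lemma contDiff_posPart_sq : ContDiff ℝ 1 fun s : ℝ => max s 0 ^ 2 := by
  rw [contDiff_one_iff_deriv]
  refine ⟨fun x => (hasDerivAt_posPart_sq x).differentiableAt, ?_⟩
  rw [show deriv (fun s : ℝ => max s 0 ^ 2) = fun x => 2 * max x 0 from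
    funext fun x => (hasDerivAt_posPart_sq x).deriv]
  fun_prop

/-- The squared distance from `k` to the interval `[l, u]`. -/
def sqDistBand (l u k : ℝ) : ℝ := max (k - u) 0 ^ 2 + max (l - k) 0 ^ 2

lemma sqDistBand_nonneg (l u k : ℝ) : 0 ≤ sqDistBand l u k := by
  unfold sqDistBand; positivity

lemma sqDistBand_eq_zero {l u k : ℝ} (hl : l ≤ k) (hu : k ≤ u) : sqDistBand l u k = 0 := by
  simp [sqDistBand, max_eq_right (sub_nonpos.2 hl), max_eq_right (sub_nonpos.2 hu)]

lemma mem_Ioo_of_sqDistBand_lt {l u k ζ : ℝ} (hζ : 0 < ζ) (hd : sqDistBand l u k < ζ ^ 2) :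
    k ∈ Ioo (l - ζ) (u + ζ) := by
  unfold sqDistBand at hd
  have h1 : max (k - u) 0 < ζ :=
    lt_of_pow_lt_pow_left₀ 2 hζ.le (by nlinarith [sq_nonneg (max (l - k) 0)])
  have h2 : max (l - k) 0 < ζ :=
    lt_of_pow_lt_pow_left₀ 2 hζ.le (by nlinarith [sq_nonneg (max (k - u) 0)])
  constructor
  · linarith [le_max_left (l - k) 0]
  · linarith [le_max_left (k - u) 0]

lemma IsViscositySolution.continuousOn_quotient
    (hρ : IsViscositySolution A b c δmin δmax ρ)
    (hK : IsAngularTrajectory A b c δmin δmax K R) :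
    ContinuousOn (fun q : ℝ × ℝ => ρ q / R q.2) halfStrip :=
  hρ.continuousOn.div
    (hK.continuousOn_radius.comp continuous_snd.continuousOn fun _ hq => hq.2)
    fun q hq => (hK.radius_pos q.2 hq.2).ne'

/-! ### The penalized minimum and the violation at a band edge. -/

/-- The supersolution inequality at a point where the quotient plus a penalty, which grows
with the distance to a moving band `[l, u]` and with the angle, attains a local minimum. -/
lemma IsViscositySolution.penalty_ineq (hosc : OscillatesCounterclockwise A b c)
    (hρ : IsViscositySolution A b c δmin δmax ρ)
    (hK : IsAngularTrajectory A b c δmin δmax K R) {k θ : ℝ} (hk : k ∈ Ioo (0 : ℝ) 1)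
    (hθ : 0 < θ) {l u χ : ℝ → ℝ} (hl : ContDiffOn ℝ 1 l (Ioi 0)) (hu : ContDiffOn ℝ 1 u (Ioi 0))
    (hχ : ContDiff ℝ 1 χ) {α : ℝ}
    (hmin : IsLocalMin (fun q : ℝ × ℝ =>
      ρ q / R q.2 + sqDistBand (l q.2) (u q.2) q.1 / α + χ q.2) (k, θ))
    {ν : ℝ} (hν : ν ∈ Icc (δmin k) (δmax k)) :
    deriv χ θ ≤ 2 * max (k - u θ) 0 / α * (deriv u θ - ν / g A b c k θ)
      + 2 * max (l θ - k) 0 / α * (ν / g A b c k θ - deriv l θ)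
      + (f A b c (K θ) θ - f A b c k θ) * (ρ (k, θ) / R θ) := by
  -- With $m$ the minimal value, $m$ minus both penalties touches the quotient from below.
  set m := ρ (k, θ) / R θ + sqDistBand (l θ) (u θ) k / α + χ θ with hm
  have hlθ := hl.contDiffAt (Ioi_mem_nhds hθ)
  have huθ := hu.contDiffAt (Ioi_mem_nhds hθ)
  have hl2 : ContDiffAt ℝ 1 (fun q : ℝ × ℝ => l q.2) (k, θ) :=
    ContDiffAt.comp (k, θ) (g := l) (f := Prod.snd) hlθ contDiffAt_snd
  have hu2 : ContDiffAt ℝ 1 (fun q : ℝ × ℝ => u q.2) (k, θ) :=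
    ContDiffAt.comp (k, θ) (g := u) (f := Prod.snd) huθ contDiffAt_snd
  have hψ : ContDiffAt ℝ 1
      (fun q : ℝ × ℝ => m - sqDistBand (l q.2) (u q.2) q.1 / α - χ q.2) (k, θ) := by
    refine (contDiffAt_const.sub (ContDiffAt.div_const ?_ _)).sub
      (hχ.contDiffAt.comp (k, θ) contDiffAt_snd)
    exact (contDiff_posPart_sq.contDiffAt.comp (k, θ) (contDiffAt_fst.sub hu2)).add
      (contDiff_posPart_sq.contDiffAt.comp (k, θ) (hl2.sub contDiffAt_fst))
  have hψk : HasDerivAt (fun s => m - sqDistBand (l θ) (u θ) s / α - χ θ)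
      (-((2 * max (k - u θ) 0 * 1 + 2 * max (l θ - k) 0 * (-1)) / α)) k := by
    have e1 := (hasDerivAt_posPart_sq (k - u θ)).comp k ((hasDerivAt_id k).sub_const (u θ))
    have e2 := (hasDerivAt_posPart_sq (l θ - k)).comp k ((hasDerivAt_id k).const_sub (l θ))
    exact (((e1.add e2).div_const α).const_sub m).sub_const (χ θ)
  have hlD := (hlθ.differentiableAt one_ne_zero).hasDerivAt
  have huD := (huθ.differentiableAt one_ne_zero).hasDerivAt
  have hψθ : HasDerivAt (fun s => m - sqDistBand (l s) (u s) k / α - χ s)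
      (-((2 * max (k - u θ) 0 * (-deriv u θ) + 2 * max (l θ - k) 0 * deriv l θ) / α)
        - deriv χ θ) θ := by
    have e1 := (hasDerivAt_posPart_sq (k - u θ)).comp θ (huD.const_sub k)
    have e2 := (hasDerivAt_posPart_sq (l θ - k)).comp θ (hlD.sub_const k)
    exact (((e1.add e2).div_const α).const_sub m).sub
      (hχ.differentiable one_ne_zero θ).hasDerivAt
  have key := hρ.quotient_ineq hosc hK hk hθ hψ (by simp only [hm]; ring)
    (by filter_upwards [hmin] with q hq
        linarith) hψk hψθ hν
  have e : ∀ x y z v w : ℝ, -((2 * x * (-v) + 2 * y * w) / α)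
      + z * -((2 * x * 1 + 2 * y * (-1)) / α)
      = 2 * x / α * (v - z) + 2 * y / α * (z - w) := by
    intros; ring
  linarith [e (max (k - u θ) 0) (max (l θ - k) 0) (ν / g A b c k θ) (deriv u θ) (deriv l θ)]

/-- If the quotient of `ρ` by the radius decreases along a trajectory, then for every narrow moving
band `[l, u]` near the trajectory there is a point just outside the band where the band edge moves
towards the point faster than the dynamics allow. -/
theorem IsViscositySolution.exists_edge_violation (hδ : IsRateBound δmin δmax)
    (hosc : OscillatesCounterclockwise A b c)
    (hρ : IsViscositySolution A b c δmin δmax ρ)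
    (hK : IsAngularTrajectory A b c δmin δmax K R) {a β e : ℝ} (ha : 0 ≤ a) (hab : a < β)
    (hbe : β < e) (hgap : ρ (K β, β) / R β < ρ (K a, a) / R a) :
    ∃ c₀ > 0, ∃ σ > 0, ∀ (l u : ℝ → ℝ) (ζ : ℝ), 0 < ζ → ζ ≤ σ →
      ContDiffOn ℝ 1 l (Ioi 0) → ContDiffOn ℝ 1 u (Ioi 0) →
      ContinuousOn l (Icc a e) → ContinuousOn u (Icc a e) →
      (∀ θ ∈ Icc a e, l θ ≤ u θ ∧ |l θ - K θ| ≤ σ ∧ |u θ - K θ| ≤ σ ∧ ζ ≤ l θ ∧ u θ ≤ 1 - ζ) →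
      ∃ θ ∈ Ioo a e, ∃ k ∈ Ioo (0 : ℝ) 1, ∃ p > 0,
        (∀ L, (∀ k₁ ∈ Icc (0 : ℝ) 1, ∀ k₂ ∈ Icc (0 : ℝ) 1,
          |ρ (k₁, θ) / R θ - ρ (k₂, θ) / R θ| ≤ L * |k₁ - k₂|) → p ≤ 2 * L) ∧
        ((u θ < k ∧ k < u θ + ζ ∧ c₀ ≤ p * (deriv u θ - δmax k / g A b c k θ)) ∨
          (k < l θ ∧ l θ - ζ < k ∧ c₀ ≤ p * (δmin k / g A b c k θ - deriv l θ))) := by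
  have hS : IsCompact (Icc (0 : ℝ) 1 ×ˢ Icc a e) := isCompact_Icc.prod isCompact_Icc
  set S : Set (ℝ × ℝ) := Icc (0 : ℝ) 1 ×ˢ Icc a e with hSdef
  set W : ℝ × ℝ → ℝ := fun q => ρ q / R q.2 with hW
  have hWc : ContinuousOn W S := (hρ.continuousOn_quotient hK).mono
    (prod_mono_right fun θ hθ => ha.trans hθ.1)
  have hfc : ContinuousOn (fun q : ℝ × ℝ => f A b c q.1 q.2) S :=
    (continuousOn_f hosc).mono (prod_mono_right (subset_univ _))
  obtain ⟨M, hM0, hM⟩ : ∃ M > 0, ∀ q ∈ S, |W q| ≤ M := by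
    obtain ⟨M, hM⟩ := hS.exists_bound_of_continuousOn hWc
    exact ⟨max M 1, by positivity, fun q hq => (hM q hq).trans (le_max_left _ _)⟩
  set γ := W (K a, a) - W (K β, β) with hγ
  have hγ0 : 0 < γ := sub_pos.2 hgap
  -- By $1+s<e^s$ this makes the exponential term at $\theta=e$ exceed $2M+\gamma$, too much for a
  -- minimizer.
  set Λ := (2 * M + γ) * 4 / γ / (e - β) with hΛ
  have hΛ0 : 0 < Λ := by have := sub_pos.2 hbe; positivity
  have hexp : 2 * M + γ < γ / 4 * Real.exp (Λ * (e - β)) := by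
    have h1 := Real.add_one_lt_exp (x := Λ * (e - β)) (by have := sub_pos.2 hbe; positivity)
    have h2 : γ / 4 * (Λ * (e - β)) = 2 * M + γ := by
      have := (sub_pos.2 hbe).ne'
      rw [hΛ]; field_simp
    nlinarith
  -- Half of the least slope of the exponential term on $[a,e]$; the other half absorbs the error in
  -- $f$.
  set c₀ := γ / 4 * Λ * Real.exp (Λ * (a - β)) / 2 with hc₀
  have hc₀0 : 0 < c₀ := by positivity
  obtain ⟨σ₁, hσ₁, hW₁⟩ := Metric.uniformContinuousOn_iff.1
    (hS.uniformContinuousOn_of_continuous hWc) (γ / 8) (by positivity)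
  obtain ⟨σ₂, hσ₂, hf₂⟩ := Metric.uniformContinuousOn_iff.1
    (hS.uniformContinuousOn_of_continuous hfc) (c₀ / M) (by positivity)
  have hσ : 0 < min σ₁ σ₂ / 3 := by positivity
  refine ⟨c₀, hc₀0, min σ₁ σ₂ / 3, hσ, ?_⟩
  -- A minimizer will lie within $\zeta\le\sigma$ of a band whose edges are within $\sigma$ of $K$,
  -- hence within $2\sigma$ of $K$; the third leaves strict room.
  set σ := min σ₁ σ₂ / 3 with hσdef
  have hσ₁' : 3 * σ ≤ σ₁ := by rw [hσdef]; linarith [min_le_left σ₁ σ₂]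
  have hσ₂' : 3 * σ ≤ σ₂ := by rw [hσdef]; linarith [min_le_right σ₁ σ₂]
  have hKmem : ∀ θ ∈ Icc a e, K θ ∈ Icc (0 : ℝ) 1 := fun θ hθ => hK.gain_mem θ (ha.trans hθ.1)
  have hWK : ∀ θ ∈ Icc a e, ∀ k ∈ Icc (0 : ℝ) 1, |k - K θ| ≤ 2 * σ →
      |W (k, θ) - W (K θ, θ)| < γ / 8 := by
    intro θ hθ k hk hd
    refine hW₁ (k, θ) ⟨hk, hθ⟩ (K θ, θ) ⟨hKmem θ hθ, hθ⟩ ?_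
    rw [dist_prod_same_right, Real.dist_eq]; linarith
  have hfK : ∀ θ ∈ Icc a e, ∀ k ∈ Icc (0 : ℝ) 1, |k - K θ| ≤ 2 * σ →
      |f A b c (K θ) θ - f A b c k θ| < c₀ / M := by
    intro θ hθ k hk hd
    refine hf₂ (K θ, θ) ⟨hKmem θ hθ, hθ⟩ (k, θ) ⟨hk, hθ⟩ ?_
    rw [dist_prod_same_right, Real.dist_eq, abs_sub_comm]; linarith
  intro l u ζ hζ hζσ hl hu hlc huc hband
  -- At distance $\zeta$ from the band the penalty is at least $2(2M+\gamma)$, which no minimizer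
  -- can afford; so the minimizer is $\zeta$-close to the band and inside the open strip.
  set α := ζ ^ 2 / (2 * (2 * M + γ)) with hα
  have hα0 : 0 < α := by positivity
  set χ : ℝ → ℝ := fun θ => γ / 4 * Real.exp (Λ * (θ - β)) with hχ
  have hχC : ContDiff ℝ 1 χ := by simp only [hχ]; fun_prop
  have hχd : ∀ θ, deriv χ θ = γ / 4 * Λ * Real.exp (Λ * (θ - β)) := by
    intro θ
    have h1 : HasDerivAt (fun θ => Λ * (θ - β)) Λ θ := by
      simpa using ((hasDerivAt_id θ).sub_const β).const_mul Λ
    have := (h1.exp.const_mul (γ / 4)).deriv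
    rw [hχ, this]; ring
  have hχ0 : ∀ θ, 0 < χ θ := fun θ => by simp only [hχ]; positivity
  set Φ : ℝ × ℝ → ℝ := fun q => ρ q / R q.2 + sqDistBand (l q.2) (u q.2) q.1 / α + χ q.2 with hΦ
  have hlc' : ContinuousOn (fun q : ℝ × ℝ => l q.2) S :=
    hlc.comp continuous_snd.continuousOn fun q hq => hq.2
  have huc' : ContinuousOn (fun q : ℝ × ℝ => u q.2) S :=
    huc.comp continuous_snd.continuousOn fun q hq => hq.2
  have hΦc : ContinuousOn Φ S := by
    refine (hWc.add (ContinuousOn.div_const ?_ _)).add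
      (hχC.continuous.comp continuous_snd).continuousOn
    exact (((continuousOn_fst.sub huc').sup continuousOn_const).pow 2).add
      (((hlc'.sub continuousOn_fst).sup continuousOn_const).pow 2)
  have hβ : β ∈ Icc a e := ⟨hab.le, hbe.le⟩
  obtain ⟨hluβ, -, huKβ, hζlβ, huζβ⟩ := hband β hβ
  have huβ : u β ∈ Icc (0 : ℝ) 1 := ⟨by linarith, by linarith⟩
  obtain ⟨⟨k, θ⟩, hqS, hqmin⟩ := hS.exists_isMinOn ⟨(u β, β), huβ, hβ⟩ hΦc
  have hkI : k ∈ Icc (0 : ℝ) 1 := hqS.1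
  have hθI : θ ∈ Icc a e := hqS.2
  obtain ⟨hlu, hlK, huK, hζl, huζ⟩ := hband θ hθI
  -- The competitor is the upper edge at angle $\beta$: it pays no distance penalty, the exponential
  -- term is $\gamma/4$ there, and the quotient is within $\gamma/8$ of its value on the trajectory.
  have hv : Φ (k, θ) ≤ W (K β, β) + γ / 8 + γ / 4 := by
    have h1 : Φ (k, θ) ≤ Φ (u β, β) := hqmin ⟨huβ, hβ⟩
    have h2 : Φ (u β, β) = W (u β, β) + γ / 4 := by
      simp [hΦ, hW, hχ, sqDistBand_eq_zero hluβ le_rfl]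
    have h3 := (abs_lt.1 (hWK β hβ (u β) huβ (by linarith))).2
    linarith
  have hΦ' : Φ (k, θ) = W (k, θ) + sqDistBand (l θ) (u θ) k / α + χ θ := rfl
  have hWl := abs_le.1 (hM (k, θ) hqS)
  have hWβ := abs_le.1 (hM (K β, β) ⟨hKmem β hβ, hβ⟩)
  have hP0 : 0 ≤ sqDistBand (l θ) (u θ) k / α := div_nonneg (sqDistBand_nonneg _ _ _) hα0.le
  have hPζ : sqDistBand (l θ) (u θ) k < ζ ^ 2 := by
    have h1 : sqDistBand (l θ) (u θ) k / α < 2 * (2 * M + γ) := by linarith [hχ0 θ]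
    rw [div_lt_iff₀ hα0, hα] at h1
    rwa [mul_div_cancel₀ _ (by positivity)] at h1
  obtain ⟨hk1, hk2⟩ := mem_Ioo_of_sqDistBand_lt hζ hPζ
  have hk : k ∈ Ioo (0 : ℝ) 1 := ⟨by linarith, by linarith⟩
  have hkK : |k - K θ| ≤ 2 * σ := by
    rw [abs_le] at *
    constructor <;> linarith
  -- At angle $a$ the quotient alone is at least $W(K(\beta),\beta)+7\gamma/8$, above the
  -- competitor's value.
  have hθa : a < θ := by
    refine lt_of_le_of_ne hθI.1 fun h => ?_
    subst h
    have := (abs_lt.1 (hWK a hθI k hkI hkK)).1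
    linarith [hχ0 a]
  have hθe : θ < e := by
    refine lt_of_le_of_ne hθI.2 fun h => ?_
    subst h
    have : χ θ = γ / 4 * Real.exp (Λ * (θ - β)) := rfl
    linarith
  have hloc : IsLocalMin Φ (k, θ) :=
    hqmin.isLocalMin (prod_mem_nhds (Icc_mem_nhds hk.1 hk.2) (Icc_mem_nhds hθa hθe))
  have key := fun ν hν => hρ.penalty_ineq hosc hK hk (ha.trans_lt hθa) hl hu hχC hloc (ν := ν) hν
  have hslope : 2 * c₀ ≤ deriv χ θ := by
    rw [hχd, hc₀]
    have : Real.exp (Λ * (a - β)) ≤ Real.exp (Λ * (θ - β)) :=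
      Real.exp_le_exp.2 (by gcongr)
    have := mul_le_mul_of_nonneg_left this (show 0 ≤ γ / 4 * Λ by positivity)
    linarith
  have herr : (f A b c (K θ) θ - f A b c k θ) * (ρ (k, θ) / R θ) ≤ c₀ := by
    refine (le_abs_self _).trans ?_
    rw [abs_mul]
    calc _ ≤ c₀ / M * M := by
          gcongr
          · exact (hfK θ hθI k hkI hkK).le
          · exact hM (k, θ) hqS
      _ = c₀ := by field_simp
  have hminmem : δmin k ∈ Icc (δmin k) (δmax k) :=
    ⟨le_rfl, (hδ.min_nonpos k hkI).trans (hδ.max_nonneg k hkI)⟩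
  have hmaxmem : δmax k ∈ Icc (δmin k) (δmax k) :=
    ⟨(hδ.min_nonpos k hkI).trans (hδ.max_nonneg k hkI), le_rfl⟩
  refine ⟨θ, ⟨hθa, hθe⟩, k, hk, ?_⟩
  rcases lt_or_ge (u θ) k with hku | hku
  · have hz1 : max (k - u θ) 0 = k - u θ := max_eq_left (by linarith)
    have hz2 : max (l θ - k) 0 = 0 := max_eq_right (by linarith)
    have hz : 0 < k - u θ := by linarith
    refine ⟨2 * (k - u θ) / α, by positivity, fun L hL => ?_, Or.inl ⟨hku, hk2, ?_⟩⟩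
    · have huI : u θ ∈ Icc (0 : ℝ) 1 := ⟨by linarith, by linarith⟩
      -- Moving to the edge at the same angle saves the penalty $(k-u)^2/\alpha$ and costs at most
      -- $L(k-u)$; hence $p=2(k-u)/\alpha\le 2L$.
      have h1 : Φ (k, θ) ≤ Φ (u θ, θ) := hqmin ⟨huI, hθI⟩
      have h2 := (abs_le.1 (hL (u θ) huI k hkI)).2
      rw [abs_sub_comm, abs_of_pos hz] at h2
      simp only [hΦ, sqDistBand_eq_zero hlu le_rfl] at h1
      simp only [sqDistBand, hz1, hz2] at h1
      have h3 : (k - u θ) * ((k - u θ) / α) ≤ (k - u θ) * L := by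
        have : (k - u θ) * ((k - u θ) / α) = ((k - u θ) ^ 2 + 0 ^ 2) / α := by ring
        rw [this]
        generalize ((k - u θ) ^ 2 + 0 ^ 2) / α = P at h1 ⊢
        rw [zero_div] at h1
        linarith
      have h4 := le_of_mul_le_mul_left h3 hz
      calc 2 * (k - u θ) / α = 2 * ((k - u θ) / α) := by ring
        _ ≤ 2 * L := by linarith
    -- Above the band the penalty slope pairs with $-\nu/g$, so $\nu=\delta_{\max}$ gives the
    -- sharpest inequality; below the band it is $\nu=\delta_{\min}$.
    · have := key _ hmaxmem
      rw [hz1, hz2] at this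
      simp only [mul_zero, zero_div, zero_mul, add_zero] at this
      linarith
  · rcases lt_or_ge k (l θ) with hkl | hkl
    · have hz1 : max (k - u θ) 0 = 0 := max_eq_right (by linarith)
      have hz2 : max (l θ - k) 0 = l θ - k := max_eq_left (by linarith)
      have hz : 0 < l θ - k := by linarith
      refine ⟨2 * (l θ - k) / α, by positivity, fun L hL => ?_, Or.inr ⟨hkl, hk1, ?_⟩⟩
      · have hlI : l θ ∈ Icc (0 : ℝ) 1 := ⟨by linarith, by linarith⟩
        have h1 : Φ (k, θ) ≤ Φ (l θ, θ) := hqmin ⟨hlI, hθI⟩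
        have h2 := (abs_le.1 (hL (l θ) hlI k hkI)).2
        rw [abs_of_pos hz] at h2
        simp only [hΦ, sqDistBand_eq_zero le_rfl hlu] at h1
        simp only [sqDistBand, hz1, hz2] at h1
        have h3 : (l θ - k) * ((l θ - k) / α) ≤ (l θ - k) * L := by
          have : (l θ - k) * ((l θ - k) / α) = (0 ^ 2 + (l θ - k) ^ 2) / α := by ring
          rw [this]
          generalize (0 ^ 2 + (l θ - k) ^ 2) / α = P at h1 ⊢
          rw [zero_div] at h1
          linarith
        have h4 := le_of_mul_le_mul_left h3 hz
        calc 2 * (l θ - k) / α = 2 * ((l θ - k) / α) := by ring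
          _ ≤ 2 * L := by linarith
      · have := key _ hminmem
        rw [hz1, hz2] at this
        simp only [mul_zero, zero_div, zero_mul, zero_add] at this
        linarith
    -- Inside the band the penalty slopes vanish, leaving $2c_0\le c_0$.
    · exfalso
      have hz1 : max (k - u θ) 0 = 0 := max_eq_right (by linarith)
      have hz2 : max (l θ - k) 0 = 0 := max_eq_right (by linarith)
      have := key _ hmaxmem
      rw [hz1, hz2] at this
      simp only [mul_zero, zero_div, zero_mul, zero_add] at this
      linarith

lemma deriv_mul_exp_mul_sub (x D a θ : ℝ) :
    deriv (fun s => x * Real.exp (D * (s - a))) θ = D * (x * Real.exp (D * (θ - a))) := by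
  have h1 : HasDerivAt (fun s => D * (s - a)) D θ := by
    simpa using ((hasDerivAt_id θ).sub_const a).const_mul D
  rw [(h1.exp.const_mul x).deriv]; ring

/-! ### Comparison along trajectories. -/

/-- A shrinking band on one side of `K`, whose edges approach each other at a rate proportional to
their distance from `K`. -/
lemma exists_shrinking_band {a e σ D : ℝ} (hae : a ≤ e) (hσ : 0 < σ) (hD : 0 ≤ D)
    (hK : ∀ θ ∈ Icc a e, K θ ∈ Icc (0 : ℝ) 1)
    (hside : (∀ θ ∈ Icc a e, 1 / 3 ≤ K θ) ∨ ∀ θ ∈ Icc a e, K θ ≤ 2 / 3) :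
    ∃ (v w : ℝ → ℝ) (ζ : ℝ), 0 < ζ ∧ ζ ≤ σ ∧ ContDiff ℝ 1 v ∧ ContDiff ℝ 1 w ∧
      ∀ θ ∈ Icc a e, v θ ≤ w θ ∧ |v θ| ≤ σ ∧ |w θ| ≤ σ ∧ ζ ≤ K θ + v θ ∧ K θ + w θ ≤ 1 - ζ ∧
        ζ ≤ |v θ| ∧ ζ ≤ |w θ| ∧ deriv v θ = D * |v θ| ∧ deriv w θ = -D * |w θ| := by
  -- The offsets $\tau e^{D(\theta-a)}$ and $B\tau e^{-D(\theta-a)}$ approach each other; this $B$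
  -- is the factor for which they meet no earlier than $e$.
  set B := Real.exp (2 * D * (e - a)) with hB
  have hB1 : 1 ≤ B := Real.one_le_exp (by have := sub_nonneg.2 hae; positivity)
  -- Offsets of at most $1/6$ keep a band on the roomy side of $K$ at least $1/6\ge\tau$ from the
  -- far side of the strip; the nearer offset, at least $\tau$, keeps it off the side that $K$ may
  -- touch.
  set τ := min σ (1 / 6) / B with hτ
  have hτ0 : 0 < τ := by positivity
  have hBτ : B * τ = min σ (1 / 6) := by rw [hτ]; field_simp
  have hBσ : B * τ ≤ σ := hBτ ▸ min_le_left _ _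
  have hB6 : B * τ ≤ 1 / 6 := hBτ ▸ min_le_right _ _
  have hτB : τ ≤ B * τ := le_mul_of_one_le_left hτ0.le hB1
  set x : ℝ → ℝ := fun θ => τ * Real.exp (D * (θ - a)) with hx
  set y : ℝ → ℝ := fun θ => B * τ * Real.exp (-D * (θ - a)) with hy
  have hxy : ∀ θ ∈ Icc a e, τ ≤ x θ ∧ x θ ≤ y θ ∧ y θ ≤ B * τ := by
    intro θ hθ
    have h1 : 0 ≤ θ - a := sub_nonneg.2 hθ.1
    have h2 : 0 ≤ e - θ := sub_nonneg.2 hθ.2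
    refine ⟨le_mul_of_one_le_right hτ0.le (Real.one_le_exp (by positivity)), ?_,
      mul_le_of_le_one_right (by positivity) (Real.exp_le_one_iff.2 (by nlinarith))⟩
    have : y θ = τ * Real.exp (2 * D * (e - a) + -D * (θ - a)) := by
      simp only [hy, hB, Real.exp_add]; ring
    rw [this]
    refine mul_le_mul_of_nonneg_left (Real.exp_le_exp.2 ?_) hτ0.le
    nlinarith [mul_nonneg hD h2]
  have hdx : ∀ θ, deriv x θ = D * x θ := deriv_mul_exp_mul_sub τ D a
  have hdy : ∀ θ, deriv y θ = -D * y θ := deriv_mul_exp_mul_sub (B * τ) (-D) a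
  have hxC : ContDiff ℝ 1 x := by simp only [hx]; fun_prop
  have hyC : ContDiff ℝ 1 y := by simp only [hy]; fun_prop
  rcases hside with hside | hside
  · refine ⟨fun θ => -y θ, fun θ => -x θ, τ, hτ0, hτB.trans hBσ, hyC.neg, hxC.neg,
      fun θ hθ => ?_⟩
    obtain ⟨h1, h2, h3⟩ := hxy θ hθ
    have h4 := (hK θ hθ).2
    have h5 := hside θ hθ
    rw [abs_neg, abs_neg, abs_of_pos (by linarith), abs_of_pos (by linarith)]
    refine ⟨by linarith, by linarith, by linarith, by linarith, by linarith, by linarith,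
      by linarith, ?_, ?_⟩
    · rw [deriv.fun_neg, hdy]; ring
    · rw [deriv.fun_neg, hdx]; ring
  · refine ⟨x, y, τ, hτ0, hτB.trans hBσ, hxC, hyC, fun θ hθ => ?_⟩
    obtain ⟨h1, h2, h3⟩ := hxy θ hθ
    have h4 := (hK θ hθ).1
    have h5 := hside θ hθ
    rw [abs_of_pos (show 0 < x θ by linarith), abs_of_pos (show 0 < y θ by linarith)]
    exact ⟨by linarith, by linarith, by linarith, by linarith, by linarith, by linarith,
      by linarith, hdx θ, hdy θ⟩

/-- Along a trajectory that keeps away from one of the two sides of the strip, the quotient of `ρ`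
by the radius does not decrease. -/
lemma quotient_le_of_side (hδ : IsRateBound δmin δmax)
    (hosc : OscillatesCounterclockwise A b c)
    (hρ : IsViscositySolution A b c δmin δmax ρ)
    (hreg : HasLipschitzRegularity δmin δmax ρ)
    (hK : IsAngularTrajectory A b c δmin δmax K R) {a β e : ℝ} (ha : 0 ≤ a) (hab : a < β)
    (hbe : β < e)
    (hside : (∀ θ ∈ Icc a e, 1 / 3 ≤ K θ) ∨ ∀ θ ∈ Icc a e, K θ ≤ 2 / 3) :
    ρ (K a, a) / R a ≤ ρ (K β, β) / R β := by
  by_contra! hgap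
  obtain ⟨c₀, hc₀, σ, hσ, H⟩ := hρ.exists_edge_violation hδ hosc hK ha hab hbe hgap
  have hKmem : ∀ θ ∈ Icc a e, K θ ∈ Icc (0 : ℝ) 1 := fun θ hθ => hK.gain_mem θ (ha.trans hθ.1)
  have hsub : Icc a e ⊆ Ici 0 := fun θ hθ => ha.trans hθ.1
  have hKc : ContinuousOn K (Icc a e) := hK.continuousOn_gain.mono hsub
  -- Both regularity cases use this statement: the edges move with $K'$ corrected by the contraction
  -- rate $D$, and $K'$ is bounded by the admissible rates at $K$.
  have band : ∀ σ' > 0, σ' ≤ σ → ∀ D, 0 ≤ D → ∃ (v w : ℝ → ℝ) (ζ : ℝ), ∃ θ ∈ Ioo a e,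
      ∃ k ∈ Ioo (0 : ℝ) 1, ∃ p > 0, |v θ| ≤ σ' ∧ |w θ| ≤ σ' ∧ ζ ≤ |v θ| ∧ ζ ≤ |w θ| ∧
        (∀ L, (∀ k₁ ∈ Icc (0 : ℝ) 1, ∀ k₂ ∈ Icc (0 : ℝ) 1,
          |ρ (k₁, θ) / R θ - ρ (k₂, θ) / R θ| ≤ L * |k₁ - k₂|) → p ≤ 2 * L) ∧
        ((|k - K θ| ≤ |w θ| + ζ ∧
          c₀ ≤ p * (δmax (K θ) / g A b c (K θ) θ - D * |w θ| - δmax k / g A b c k θ)) ∨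
        (|k - K θ| ≤ |v θ| + ζ ∧
          c₀ ≤ p * (δmin k / g A b c k θ - (δmin (K θ) / g A b c (K θ) θ + D * |v θ|)))) := by
    intro σ' hσ'0 hσ' D hD
    obtain ⟨v, w, ζ, hζ, hζσ, hv, hw, hband⟩ :=
      exists_shrinking_band (hab.trans hbe).le hσ'0 hD hKmem hside
    obtain ⟨θ, hθ, k, hk, p, hp, hL, hviol⟩ := H (fun θ => K θ + v θ) (fun θ => K θ + w θ) ζ hζ
      (hζσ.trans hσ') (hK.contDiffOn_gain.add hv.contDiffOn) (hK.contDiffOn_gain.add hw.contDiffOn)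
      (hKc.add hv.continuous.continuousOn) (hKc.add hw.continuous.continuousOn)
      (fun θ hθ => by
        obtain ⟨h1, h2, h3, h4, h5, -⟩ := hband θ hθ
        refine ⟨by linarith, ?_, ?_, h4, h5⟩
        · rw [add_sub_cancel_left]; linarith
        · rw [add_sub_cancel_left]; linarith)
    obtain ⟨-, h2, h3, h4, h5, h6, h7, h8, h9⟩ := hband θ (Ioo_subset_Icc_self hθ)
    have hθ0 : 0 < θ := ha.trans_lt hθ.1
    have hKd : DifferentiableAt ℝ K θ :=
      (hK.contDiffOn_gain.contDiffAt (Ioi_mem_nhds hθ0)).differentiableAt one_ne_zero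
    have hrate := hK.deriv_gain_mem θ hθ0
    rw [deriv_fun_add hKd (hv.differentiable one_ne_zero θ),
      deriv_fun_add hKd (hw.differentiable one_ne_zero θ), h8, h9] at hviol
    refine ⟨v, w, ζ, θ, hθ, k, hk, p, hp, h2, h3, h6, h7, hL, ?_⟩
    rcases hviol with ⟨h10, h11, h12⟩ | ⟨h10, h11, h12⟩
    · refine Or.inl ⟨?_, h12.trans (mul_le_mul_of_nonneg_left ?_ hp.le)⟩
      · rw [abs_le]; constructor <;> linarith [le_abs_self (w θ), neg_abs_le (w θ)]
      · linarith [hrate.2]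
    · refine Or.inr ⟨?_, h12.trans (mul_le_mul_of_nonneg_left ?_ hp.le)⟩
      · rw [abs_le]; constructor <;> linarith [le_abs_self (v θ), neg_abs_le (v θ)]
      · linarith [hrate.1]
  rcases hreg with ⟨hLmin, hLmax⟩ | hLip
  · obtain ⟨C₁, hC₁, hmin⟩ := exists_abs_div_g_sub_le hosc hLmin
    obtain ⟨C₂, hC₂, hmax⟩ := exists_abs_div_g_sub_le hosc hLmax
    -- The violating point satisfies $|k-K|\le|w|+\zeta\le 2|w|$ (or the same with $v$), so
    -- contraction at rate $2(C_1+C_2)$ outweighs the Lipschitz error of the rate bound.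
    obtain ⟨v, w, ζ, θ, hθ, k, hk, p, hp, -, -, hζv, hζw, -, hviol⟩ :=
      band σ hσ le_rfl (2 * (C₁ + C₂)) (by positivity)
    have hkI := Ioo_subset_Icc_self hk
    have hKI := hKmem θ (Ioo_subset_Icc_self hθ)
    have hd := abs_nonneg (k - K θ)
    rcases hviol with ⟨h1, h2⟩ | ⟨h1, h2⟩
    · have h3 := pos_of_mul_pos_right (hc₀.trans_le h2) hp.le
      have h4 := (abs_le.1 (hmax k hkI (K θ) hKI θ)).1
      nlinarith [abs_nonneg (w θ)]
    · have h3 := pos_of_mul_pos_right (hc₀.trans_le h2) hp.le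
      have h4 := (abs_le.1 (hmin k hkI (K θ) hKI θ)).2
      nlinarith [abs_nonneg (v θ)]
  · have hS : IsCompact (Icc (0 : ℝ) 1 ×ˢ Icc a e) := isCompact_Icc.prod isCompact_Icc
    have hSsub : Icc (0 : ℝ) 1 ×ˢ Icc a e ⊆ halfStrip := prod_mono_right hsub
    obtain ⟨L, hL0, hL⟩ : ∃ L > 0, ∀ θ ∈ Icc a e, ∀ k₁ ∈ Icc (0 : ℝ) 1, ∀ k₂ ∈ Icc (0 : ℝ) 1,
        |ρ (k₁, θ) / R θ - ρ (k₂, θ) / R θ| ≤ L * |k₁ - k₂| := by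
      obtain ⟨L, hL⟩ := (hLip.mono hSsub).exists_lipschitzOnWith_of_compact hS
      obtain ⟨θ₀, hθ₀, hmin⟩ := isCompact_Icc.exists_isMinOn
        (nonempty_Icc.2 (hab.trans hbe).le) (hK.continuousOn_radius.mono hsub)
      have hR0 := hK.radius_pos θ₀ (hsub hθ₀)
      refine ⟨L / R θ₀ + 1, by positivity, fun θ hθ k₁ hk₁ k₂ hk₂ => ?_⟩
      have h1 := hL.dist_le_mul (k₁, θ) ⟨hk₁, hθ⟩ (k₂, θ) ⟨hk₂, hθ⟩
      rw [dist_prod_same_right, Real.dist_eq, Real.dist_eq] at h1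
      have hR := hK.radius_pos θ (hsub hθ)
      rw [← sub_div, abs_div, abs_of_pos hR]
      have h2 : |ρ (k₁, θ) - ρ (k₂, θ)| / R θ ≤ L * |k₁ - k₂| / R θ₀ := by
        gcongr
        exact hmin hθ
      have e : (L / R θ₀ + 1) * |k₁ - k₂| = L * |k₁ - k₂| / R θ₀ + |k₁ - k₂| := by ring
      linarith [abs_nonneg (k₁ - k₂)]
    have unif : ∀ δ : ℝ → ℝ, ContinuousOn δ (Icc 0 1) → ∃ τ > 0, ∀ θ ∈ Icc a e,
        ∀ k ∈ Icc (0 : ℝ) 1, |k - K θ| < τ →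
        |δ k / g A b c k θ - δ (K θ) / g A b c (K θ) θ| < c₀ / (2 * L) := by
      intro δ hδc
      have hc : ContinuousOn (fun q : ℝ × ℝ => δ q.1 / g A b c q.1 q.2)
          (Icc (0 : ℝ) 1 ×ˢ Icc a e) :=
        (hδc.comp continuousOn_fst fun q hq => hq.1).div continuous_g.continuousOn
          fun q hq => (hosc q.1 hq.1 q.2).ne'
      obtain ⟨τ, hτ, h⟩ := Metric.uniformContinuousOn_iff.1
        (hS.uniformContinuousOn_of_continuous hc) (c₀ / (2 * L)) (by positivity)
      refine ⟨τ, hτ, fun θ hθ k hk hd => h (k, θ) ⟨hk, hθ⟩ (K θ, θ) ⟨hKmem θ hθ, hθ⟩ ?_⟩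
      rwa [dist_prod_same_right, Real.dist_eq]
    obtain ⟨τ₁, hτ₁, hmin⟩ := unif δmin hδ.continuousOn_min
    obtain ⟨τ₂, hτ₂, hmax⟩ := unif δmax hδ.continuousOn_max
    -- No contraction is needed: $p\le 2L$, while uniform continuity keeps the rate difference below
    -- $c_0/(2L)$ for $|k-K|\le 2\sigma'$.
    obtain ⟨v, w, ζ, θ, hθ, k, hk, p, hp, hv, hw, hζv, hζw, hpL, hviol⟩ :=
      band (min σ (min τ₁ τ₂ / 3)) (by positivity) (min_le_left _ _) 0 le_rfl
    have hθI := Ioo_subset_Icc_self hθ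
    have hkI := Ioo_subset_Icc_self hk
    have hp2 := hpL L (hL θ hθI)
    have m1 := min_le_right σ (min τ₁ τ₂ / 3)
    have m2 := min_le_left τ₁ τ₂
    have m3 := min_le_right τ₁ τ₂
    have absurd_of : ∀ d, c₀ ≤ p * d → d < c₀ / (2 * L) → False := by
      intro d h1 h2
      have h3 := mul_lt_mul_of_pos_left h2 hp
      have h4 : p * (c₀ / (2 * L)) ≤ 2 * L * (c₀ / (2 * L)) := by gcongr
      have h5 : 2 * L * (c₀ / (2 * L)) = c₀ := by field_simp
      linarith
    rcases hviol with ⟨h1, h2⟩ | ⟨h1, h2⟩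
    · refine absurd_of _ h2 ?_
      linarith [(abs_lt.1 (hmax θ hθI k hkI (by linarith))).1]
    · refine absurd_of _ h2 ?_
      linarith [(abs_lt.1 (hmin θ hθI k hkI (by linarith))).2]

/-- Comparison along trajectories: the quotient of `ρ` by the radius does not fall below its initial
value. -/
theorem quotient_zero_le (hδ : IsRateBound δmin δmax)
    (hosc : OscillatesCounterclockwise A b c)
    (hρ : IsViscositySolution A b c δmin δmax ρ)
    (hreg : HasLipschitzRegularity δmin δmax ρ)
    (hK : IsAngularTrajectory A b c δmin δmax K R) {T : ℝ} (hT : 0 ≤ T) :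
    ρ (K 0, 0) / R 0 ≤ ρ (K T, T) / R T := by
  set V : ℝ → ℝ := fun θ => ρ (K θ, θ) / R θ with hV
  have hVc : ContinuousOn V (Icc 0 T) := by
    refine ((hρ.continuousOn_quotient hK).comp (f := fun θ => (K θ, θ))
      (hK.continuousOn_gain.prodMk continuousOn_id) fun θ hθ => ?_).mono Icc_subset_Ici_self
    exact ⟨hK.gain_mem θ hθ, hθ⟩
  have hclosed : IsClosed ({θ | V 0 ≤ V θ} ∩ Icc 0 T) := by
    rw [inter_comm]
    exact hVc.preimage_isClosed_of_isClosed isClosed_Icc isClosed_Ici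
  -- Continuous induction on $[0,T]$: just to the right of any angle, continuity keeps $K$ away from
  -- one side of the strip.
  refine hclosed.Icc_subset_of_forall_mem_nhdsWithin (show V 0 ≤ V 0 from le_rfl) ?_ ⟨hT, le_rfl⟩
  rintro x ⟨hx, hxT⟩
  have hKx : ContinuousWithinAt K (Ici x) x :=
    (hK.continuousOn_gain x hxT.1).mono (Ici_subset_Ici.2 hxT.1)
  obtain ⟨e, hxe, hside⟩ : ∃ e > x,
      (∀ θ ∈ Icc x e, 1 / 3 ≤ K θ) ∨ ∀ θ ∈ Icc x e, K θ ≤ 2 / 3 := by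
    rcases lt_or_ge (1 / 3) (K x) with h1 | h1
    · obtain ⟨e, he, h⟩ := (mem_nhdsGE_iff_exists_Icc_subset).1 (hKx (Ioi_mem_nhds h1))
      exact ⟨e, he, Or.inl fun θ hθ => le_of_lt (h hθ)⟩
    · obtain ⟨e, he, h⟩ := (mem_nhdsGE_iff_exists_Icc_subset).1
        (hKx (Iio_mem_nhds (show K x < 2 / 3 by linarith)))
      exact ⟨e, he, Or.inr fun θ hθ => le_of_lt (h hθ)⟩
  filter_upwards [Ioo_mem_nhdsGT hxe] with y hy
  exact le_trans hx (quotient_le_of_side hδ hosc hρ hreg hK hxT.1 hy.1 hy.2 hside)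

/-! ### Polar coordinates along a closed-loop solution. -/

/-- The factor 2 compares the Euclidean norm with the supremum norm that `Fin 2 → ℝ` carries; the
principal argument bounds the angle by $\pi$. -/
lemma exists_polar {v : Fin 2 → ℝ} (hv : v ≠ 0) :
    ∃ r > 0, r ≤ 2 * ‖v‖ ∧ ∃ φ, |φ| ≤ Real.pi ∧ v = r • radial φ := by
  set z : ℂ := ⟨v 0, v 1⟩ with hz
  have hz0 : z ≠ 0 := by
    intro h0
    apply hv
    ext i
    fin_cases i
    · exact congrArg Complex.re h0
    · exact congrArg Complex.im h0
  refine ⟨‖z‖, norm_pos_iff.2 hz0, ?_, z.arg, Complex.abs_arg_le_pi z, ?_⟩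
  · have h1 := Complex.norm_le_abs_re_add_abs_im z
    have h2 : |z.re| ≤ ‖v‖ := norm_le_pi_norm v 0
    have h3 : |z.im| ≤ ‖v‖ := norm_le_pi_norm v 1
    linarith
  · ext i
    fin_cases i
    · simp [radial, Complex.norm_mul_cos_arg, hz]
    · simp [radial, Complex.norm_mul_sin_arg, hz]

lemma norm_radial_le (φ : ℝ) : ‖radial φ‖ ≤ 1 := by
  rw [pi_norm_le_iff_of_nonneg zero_le_one]
  intro i
  fin_cases i
  · exact Real.abs_cos_le_one φ
  · exact Real.abs_sin_le_one φ

/-- The vector field of the closed loop in terms of the frozen-gain matrix. -/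
lemma vectorField_eq (k : ℝ) (v : Fin 2 → ℝ) :
    A *ᵥ v + (k * (c ⬝ᵥ v)) • b = closedLoopMatrix A b c k *ᵥ v := by
  ext i
  fin_cases i <;>
  · simp [closedLoopMatrix, Matrix.mulVec, dotProduct, Fin.sum_univ_two, vecMulVec]
    ring

/-- The radial rate at the vector `v`. -/
def radialRate (A : Matrix (Fin 2) (Fin 2) ℝ) (b c : Fin 2 → ℝ) (k : ℝ) (v : Fin 2 → ℝ) : ℝ :=
  v ⬝ᵥ (closedLoopMatrix A b c k *ᵥ v) / (v ⬝ᵥ v)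

/-- The angular rate at the vector `v`. -/
def angularRate (A : Matrix (Fin 2) (Fin 2) ℝ) (b c : Fin 2 → ℝ) (k : ℝ) (v : Fin 2 → ℝ) : ℝ :=
  ![-v 1, v 0] ⬝ᵥ (closedLoopMatrix A b c k *ᵥ v) / (v ⬝ᵥ v)

lemma radial_dotProduct_self (φ : ℝ) : radial φ ⬝ᵥ radial φ = 1 := by
  simp [radial, dotProduct, Fin.sum_univ_two, ← sq]

lemma radialRate_smul_radial (k : ℝ) {r : ℝ} (hr : r ≠ 0) (φ : ℝ) :
    radialRate A b c k (r • radial φ) = h A b c k φ := by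
  simp only [radialRate, mulVec_smul, smul_dotProduct, dotProduct_smul, smul_eq_mul,
    radial_dotProduct_self, h]
  field_simp

lemma angularRate_smul_radial (k : ℝ) {r : ℝ} (hr : r ≠ 0) (φ : ℝ) :
    angularRate A b c k (r • radial φ) = g A b c k φ := by
  have : ![-(r • radial φ) 1, (r • radial φ) 0] = r • angular φ := by
    ext i; fin_cases i <;> simp [radial, angular]
  simp only [angularRate, this, mulVec_smul, smul_dotProduct, dotProduct_smul, smul_eq_mul,
    radial_dotProduct_self, g]
  field_simp

lemma dotProduct_self_pos_of_ne_zero {v : Fin 2 → ℝ} (hv : v ≠ 0) : 0 < v ⬝ᵥ v := by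
  obtain ⟨r, hr, -, φ, -, rfl⟩ := exists_polar hv
  rw [smul_dotProduct, dotProduct_smul, radial_dotProduct_self]
  simp only [smul_eq_mul]; positivity

/-- Expansion in the orthogonal frame formed by $v$ and its quarter-turn. -/
lemma mulVec_eq_rates {k : ℝ} {v : Fin 2 → ℝ} (hv : v ≠ 0) :
    (closedLoopMatrix A b c k *ᵥ v) 0
        = radialRate A b c k v * v 0 - angularRate A b c k v * v 1 ∧
      (closedLoopMatrix A b c k *ᵥ v) 1
        = radialRate A b c k v * v 1 + angularRate A b c k v * v 0 := by
  have h1 := (dotProduct_self_pos_of_ne_zero hv).ne'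
  have h2 : v ⬝ᵥ v = v 0 * v 0 + v 1 * v 1 := by simp [dotProduct, Fin.sum_univ_two]
  have h3 : ∀ w : Fin 2 → ℝ, v ⬝ᵥ w = v 0 * w 0 + v 1 * w 1 := fun w => by
    simp [dotProduct, Fin.sum_univ_two]
  have h4 : ∀ w : Fin 2 → ℝ, ![-v 1, v 0] ⬝ᵥ w = -v 1 * w 0 + v 0 * w 1 := fun w => by
    simp [dotProduct, Fin.sum_univ_two]
  simp only [radialRate, angularRate, h4]
  rw [h2] at h1
  rw [h3, h3]
  constructor <;>
  · rw [div_mul_eq_mul_div, div_mul_eq_mul_div]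
    first | rw [← sub_div] | rw [← add_div]
    rw [eq_div_iff h1]
    ring

lemma continuous_mulVec_apply {k : ℝ → ℝ} {X : ℝ → Fin 2 → ℝ} (hk : Continuous k)
    (hX : Continuous X) (i : Fin 2) :
    Continuous fun t => (closedLoopMatrix A b c (k t) *ᵥ X t) i := by
  have h0 : Continuous fun t => X t 0 := (continuous_apply 0).comp hX
  have h1 : Continuous fun t => X t 1 := (continuous_apply 1).comp hX
  simp only [closedLoopMatrix, Matrix.mulVec, dotProduct, Fin.sum_univ_two, Matrix.add_apply,
    Matrix.smul_apply, vecMulVec_apply, smul_eq_mul]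
  exact ((continuous_const.add (hk.mul continuous_const)).mul h0).add
    ((continuous_const.add (hk.mul continuous_const)).mul h1)

lemma continuous_radialRate {k : ℝ → ℝ} {X : ℝ → Fin 2 → ℝ} (hk : Continuous k)
    (hX : Continuous X) (hX0 : ∀ t, X t ≠ 0) :
    Continuous fun t => radialRate A b c (k t) (X t) := by
  have hXi : ∀ i, Continuous fun t => X t i := fun i => (continuous_apply i).comp hX
  refine Continuous.div ?_ ?_ fun t => (dotProduct_self_pos_of_ne_zero (hX0 t)).ne'
  · exact continuous_finsetSum _ fun i _ => (hXi i).mul (continuous_mulVec_apply hk hX i)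
  · exact continuous_finsetSum _ fun i _ => (hXi i).mul (hXi i)

lemma continuous_angularRate {k : ℝ → ℝ} {X : ℝ → Fin 2 → ℝ} (hk : Continuous k)
    (hX : Continuous X) (hX0 : ∀ t, X t ≠ 0) :
    Continuous fun t => angularRate A b c (k t) (X t) := by
  have hXi : ∀ i, Continuous fun t => X t i := fun i => (continuous_apply i).comp hX
  refine Continuous.div ?_ ?_ fun t => (dotProduct_self_pos_of_ne_zero (hX0 t)).ne'
  · refine continuous_finsetSum _ fun i _ => Continuous.mul ?_ (continuous_mulVec_apply hk hX i)
    fin_cases i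
    · exact (hXi 1).neg
    · exact hXi 0
  · exact continuous_finsetSum _ fun i _ => (hXi i).mul (hXi i)

lemma abs_dotProduct_mulVec_le {H : ℝ} (hH : ∀ k ∈ Icc (0 : ℝ) 1, ∀ θ, |h A b c k θ| ≤ H) {k : ℝ}
    (hk : k ∈ Icc (0 : ℝ) 1) (v : Fin 2 → ℝ) :
    |v ⬝ᵥ (closedLoopMatrix A b c k *ᵥ v)| ≤ H * (v ⬝ᵥ v) := by
  rcases eq_or_ne v 0 with rfl | hv
  · simp
  · have h1 := dotProduct_self_pos_of_ne_zero hv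
    obtain ⟨r, hr, -, φ, -, hφ⟩ := exists_polar hv
    have h2 := hH k hk φ
    rw [← radialRate_smul_radial k hr.ne' φ, ← hφ, radialRate, abs_div, abs_of_pos h1,
      div_le_iff₀ h1] at h2
    exact h2

namespace IsClosedLoopSolution

lemma continuousOn (hx : IsClosedLoopSolution A b c κ t₀ x) : ContinuousOn x (Ici t₀) :=
  fun t ht => (hx t ht).continuousWithinAt

lemma hasDerivWithinAt_apply (hx : IsClosedLoopSolution A b c κ t₀ x) {t : ℝ} (ht : t₀ ≤ t)
    (i : Fin 2) :
    HasDerivWithinAt (fun s => x s i) ((closedLoopMatrix A b c (κ t) *ᵥ x t) i) (Ici t₀) t := by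
  have h1 := hx t ht
  rw [vectorField_eq] at h1
  exact (hasDerivWithinAt_pi.1 h1) i

/-- When $H$ bounds the radial rate, the weight $e^{2Hs}$ makes the energy nondecreasing and
$e^{-2Hs}$ makes it nonincreasing. A solution thus neither reaches nor leaves the origin. -/
lemma hasDerivAt_energy (hx : IsClosedLoopSolution A b c κ t₀ x) {t : ℝ} (ht : t₀ < t) (H : ℝ) :
    HasDerivAt (fun s => (x s ⬝ᵥ x s) * Real.exp (2 * H * s))
      (2 * (x t ⬝ᵥ (closedLoopMatrix A b c (κ t) *ᵥ x t) + H * (x t ⬝ᵥ x t))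
        * Real.exp (2 * H * t)) t := by
  have h0 := (hx.hasDerivWithinAt_apply ht.le 0).hasDerivAt (Ici_mem_nhds ht)
  have h1 := (hx.hasDerivWithinAt_apply ht.le 1).hasDerivAt (Ici_mem_nhds ht)
  have h2 : HasDerivAt (fun s => 2 * H * s) (2 * H) t := by
    simpa using (hasDerivAt_id t).const_mul (2 * H)
  have h3 := ((h0.mul h0).add (h1.mul h1)).mul h2.exp
  simp only [dotProduct, Fin.sum_univ_two]
  refine h3.congr_deriv ?_
  simp only [Pi.add_apply, Pi.mul_apply]
  ring

lemma continuousOn_energy (hx : IsClosedLoopSolution A b c κ t₀ x) (H : ℝ) :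
    ContinuousOn (fun s => (x s ⬝ᵥ x s) * Real.exp (2 * H * s)) (Ici t₀) := by
  have h0 : ∀ i, ContinuousOn (fun s => x s i) (Ici t₀) :=
    fun i => (continuous_apply i).comp_continuousOn hx.continuousOn
  simp only [dotProduct, Fin.sum_univ_two]
  exact (((h0 0).mul (h0 0)).add ((h0 1).mul (h0 1))).mul (by fun_prop)

lemma ne_zero (hx : IsClosedLoopSolution A b c κ t₀ x)
    (hκ : ∀ t, t₀ ≤ t → κ t ∈ Icc (0 : ℝ) 1) (h0 : x t₀ ≠ 0) {t : ℝ} (ht : t₀ ≤ t) : x t ≠ 0 := by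
  obtain ⟨H, -, hH⟩ := exists_abs_h_le A b c
  have hmono : MonotoneOn (fun s => (x s ⬝ᵥ x s) * Real.exp (2 * H * s)) (Ici t₀) := by
    refine monotoneOn_of_deriv_nonneg (convex_Ici _) (hx.continuousOn_energy H) ?_ ?_
    · rw [interior_Ici]
      exact fun s hs => (hx.hasDerivAt_energy hs H).differentiableAt.differentiableWithinAt
    · rw [interior_Ici]
      intro s hs
      rw [(hx.hasDerivAt_energy hs H).deriv]
      have := (abs_le.1 (abs_dotProduct_mulVec_le hH (hκ s (le_of_lt hs)) (x s))).1
      have : 0 ≤ x s ⬝ᵥ (closedLoopMatrix A b c (κ s) *ᵥ x s) + H * (x s ⬝ᵥ x s) := by linarith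
      positivity
  intro hxt
  have h1 := hmono self_mem_Ici ht ht
  have h2 := mul_pos (dotProduct_self_pos_of_ne_zero h0) (Real.exp_pos (2 * H * t₀))
  simp only [hxt, dotProduct_zero, zero_mul] at h1
  linarith

lemma eq_zero (hx : IsClosedLoopSolution A b c κ t₀ x)
    (hκ : ∀ t, t₀ ≤ t → κ t ∈ Icc (0 : ℝ) 1) (h0 : x t₀ = 0) {t : ℝ} (ht : t₀ ≤ t) : x t = 0 := by
  obtain ⟨H, -, hH⟩ := exists_abs_h_le A b c
  have hanti : AntitoneOn (fun s => (x s ⬝ᵥ x s) * Real.exp (2 * -H * s)) (Ici t₀) := by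
    refine antitoneOn_of_deriv_nonpos (convex_Ici _) (hx.continuousOn_energy (-H)) ?_ ?_
    · rw [interior_Ici]
      exact fun s hs => (hx.hasDerivAt_energy hs (-H)).differentiableAt.differentiableWithinAt
    · rw [interior_Ici]
      intro s hs
      rw [(hx.hasDerivAt_energy hs (-H)).deriv]
      have := (abs_le.1 (abs_dotProduct_mulVec_le hH (hκ s (le_of_lt hs)) (x s))).2
      exact mul_nonpos_of_nonpos_of_nonneg (by linarith) (Real.exp_pos _).le
  by_contra hxt
  have h1 := hanti self_mem_Ici ht ht
  have h2 := mul_pos (dotProduct_self_pos_of_ne_zero hxt) (Real.exp_pos (2 * -H * t))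
  simp only [h0, dotProduct_zero, zero_mul] at h1
  linarith

/-- Polar coordinates along a nonzero solution; the radius is `r₀ exp (Λ t)`. Before the initial
time, the angle and the logarithmic radius are continued with constant rates. -/
theorem exists_polar_coordinates (hx : IsClosedLoopSolution A b c κ t₀ x)
    (hκc : ContinuousOn κ (Ici t₀)) (hκ : ∀ t, t₀ ≤ t → κ t ∈ Icc (0 : ℝ) 1) (h0 : x t₀ ≠ 0)
    {m H : ℝ} (hm : ∀ k ∈ Icc (0 : ℝ) 1, ∀ θ, m ≤ g A b c k θ)
    (hH : ∀ k ∈ Icc (0 : ℝ) 1, ∀ θ, |h A b c k θ| ≤ H) :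
    ∃ r₀ > 0, r₀ ≤ 2 * ‖x t₀‖ ∧ ∃ Θ Λ ω η : ℝ → ℝ, Continuous ω ∧ Continuous η ∧
      (∀ t, HasDerivAt Θ (ω t) t) ∧ (∀ t, HasDerivAt Λ (η t) t) ∧
      (∀ t, m ≤ ω t) ∧ (∀ t, |η t| ≤ H) ∧ |Θ t₀| ≤ Real.pi ∧ Λ t₀ = 0 ∧
      ∀ t, t₀ ≤ t → x t = (r₀ * Real.exp (Λ t)) • radial (Θ t) ∧
        ω t = g A b c (κ t) (Θ t) ∧ η t = h A b c (κ t) (Θ t) := by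
  obtain ⟨r₀, hr₀, hr₀le, θ₀, hθ₀, hxθ₀⟩ := exists_polar h0
  set X : ℝ → Fin 2 → ℝ := fun t => x (max t t₀) with hX
  set k : ℝ → ℝ := fun t => κ (max t t₀) with hk
  have hmax : Continuous fun t => max t t₀ := by fun_prop
  have hXc : Continuous X := hx.continuousOn.comp_continuous hmax fun t => mem_Ici.2 (le_max_right _ _)
  have hkc : Continuous k := hκc.comp_continuous hmax fun t => mem_Ici.2 (le_max_right _ _)
  have hX0 : ∀ t, X t ≠ 0 := fun t => hx.ne_zero hκ h0 (le_max_right _ _)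
  have hk01 : ∀ t, k t ∈ Icc (0 : ℝ) 1 := fun t => hκ _ (le_max_right _ _)
  set ω : ℝ → ℝ := fun t => angularRate A b c (k t) (X t) with hω
  set η : ℝ → ℝ := fun t => radialRate A b c (k t) (X t) with hη
  have hωc : Continuous ω := continuous_angularRate hkc hXc hX0
  have hηc : Continuous η := continuous_radialRate hkc hXc hX0
  set Θ : ℝ → ℝ := fun t => θ₀ + ∫ s in t₀..t, ω s with hΘ
  set Λ : ℝ → ℝ := fun t => ∫ s in t₀..t, η s with hΛ
  have hΘd : ∀ t, HasDerivAt Θ (ω t) t := fun t =>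
    (hωc.integral_hasStrictDerivAt t₀ t).hasDerivAt.const_add θ₀
  have hΛd : ∀ t, HasDerivAt Λ (η t) t := fun t =>
    (hηc.integral_hasStrictDerivAt t₀ t).hasDerivAt
  have hΘ0 : Θ t₀ = θ₀ := by simp [hΘ]
  have hΛ0 : Λ t₀ = 0 := by simp [hΛ]
  have hx0 : x t₀ 0 = r₀ * Real.cos θ₀ := by
    conv_lhs => rw [hxθ₀]
    simp [radial]
  have hx1 : x t₀ 1 = r₀ * Real.sin θ₀ := by
    conv_lhs => rw [hxθ₀]
    simp [radial]
  have hΘC : Continuous Θ := continuous_iff_continuousAt.2 fun t => (hΘd t).continuousAt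
  have hΛC : Continuous Λ := continuous_iff_continuousAt.2 fun t => (hΛd t).continuousAt
  have hxi : ∀ i, ContinuousOn (fun s => x s i) (Ici t₀) :=
    fun i => (continuous_apply i).comp_continuousOn hx.continuousOn
  have hxd : ∀ t, t₀ ≤ t →
      HasDerivWithinAt (fun s => x s 0) (η t * x t 0 - ω t * x t 1) (Ici t) t ∧
      HasDerivWithinAt (fun s => x s 1) (η t * x t 1 + ω t * x t 0) (Ici t) t := by
    intro t ht
    have e : max t t₀ = t := max_eq_left ht
    have h1 := mulVec_eq_rates (A := A) (b := b) (c := c) (k := k t) (hX0 t)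
    have hXt : X t = x t := by simp only [hX, e]
    have hkt : k t = κ t := by simp only [hk, e]
    have e1 : η t = radialRate A b c (κ t) (x t) := by simp only [hη, hXt, hkt]
    have e2 : ω t = angularRate A b c (κ t) (x t) := by simp only [hω, hXt, hkt]
    rw [hXt, hkt, ← e1, ← e2] at h1
    have d0 := (hx.hasDerivWithinAt_apply ht 0).mono (Ici_subset_Ici.2 ht)
    have d1 := (hx.hasDerivWithinAt_apply ht 1).mono (Ici_subset_Ici.2 ht)
    rw [h1.1] at d0
    rw [h1.2] at d1
    exact ⟨d0, d1⟩
  -- Rotating $x$ back by $\Theta$ and rescaling by $e^{-\Lambda}$ gives a curve of zero derivative,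
  -- hence the constant $(r_0,0)$.
  have hconst : ∀ t, t₀ ≤ t →
      (x t 0 * Real.cos (Θ t) + x t 1 * Real.sin (Θ t)) * Real.exp (-Λ t) = r₀ ∧
      (-x t 0 * Real.sin (Θ t) + x t 1 * Real.cos (Θ t)) * Real.exp (-Λ t) = 0 := by
    intro t ht
    have sub : Icc t₀ t ⊆ Ici t₀ := Icc_subset_Ici_self
    constructor
    · have := constant_of_has_deriv_right_zero (a := t₀) (b := t)
        (f := fun t => (x t 0 * Real.cos (Θ t) + x t 1 * Real.sin (Θ t)) * Real.exp (-Λ t))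
        ((((hxi 0).mono sub).mul (by fun_prop)).add (((hxi 1).mono sub).mul (by fun_prop))
          |>.mul (by fun_prop)) ?_ t ⟨ht, le_rfl⟩
      · rw [this]
        simp only [hΘ0, hΛ0, hx0, hx1, neg_zero, Real.exp_zero, mul_one]
        linear_combination r₀ * Real.cos_sq_add_sin_sq θ₀
      · intro s hs
        obtain ⟨d0, d1⟩ := hxd s hs.1
        have dc := (hΘd s).cos.hasDerivWithinAt (s := Ici s)
        have ds := (hΘd s).sin.hasDerivWithinAt (s := Ici s)
        have de := (hΛd s).neg.exp.hasDerivWithinAt (s := Ici s)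
        refine (((d0.mul dc).add (d1.mul ds)).mul de).congr_deriv ?_
        simp only [Pi.add_apply, Pi.mul_apply, Pi.neg_apply]
        ring
    · have := constant_of_has_deriv_right_zero (a := t₀) (b := t)
        (f := fun t => (-x t 0 * Real.sin (Θ t) + x t 1 * Real.cos (Θ t)) * Real.exp (-Λ t))
        ((((hxi 0).mono sub).neg.mul (by fun_prop)).add (((hxi 1).mono sub).mul (by fun_prop))
          |>.mul (by fun_prop)) ?_ t ⟨ht, le_rfl⟩
      · rw [this]
        simp only [hΘ0, hΛ0, hx0, hx1, neg_zero, Real.exp_zero, mul_one]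
        ring
      · intro s hs
        obtain ⟨d0, d1⟩ := hxd s hs.1
        have dc := (hΘd s).cos.hasDerivWithinAt (s := Ici s)
        have ds := (hΘd s).sin.hasDerivWithinAt (s := Ici s)
        have de := (hΛd s).neg.exp.hasDerivWithinAt (s := Ici s)
        refine (((d0.neg.mul ds).add (d1.mul dc)).mul de).congr_deriv ?_
        simp only [Pi.add_apply, Pi.mul_apply, Pi.neg_apply]
        ring
  refine ⟨r₀, hr₀, hr₀le, Θ, Λ, ω, η, hωc, hηc, hΘd, hΛd, fun t => ?_, fun t => ?_,
    by rwa [hΘ0], hΛ0, fun t ht => ?_⟩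
  · obtain ⟨r, hr, -, φ, -, hφ⟩ := exists_polar (hX0 t)
    simp only [hω]
    rw [hφ, angularRate_smul_radial _ hr.ne']
    exact hm _ (hk01 t) φ
  · obtain ⟨r, hr, -, φ, -, hφ⟩ := exists_polar (hX0 t)
    simp only [hη]
    rw [hφ, radialRate_smul_radial _ hr.ne']
    exact hH _ (hk01 t) φ
  · have hxt : x t = (r₀ * Real.exp (Λ t)) • radial (Θ t) := by
      obtain ⟨e1, e2⟩ := hconst t ht
      rw [Real.exp_neg] at e1 e2
      have hE := (Real.exp_pos (Λ t)).ne'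
      field_simp at e1 e2
      have hcs := Real.cos_sq_add_sin_sq (Θ t)
      ext i
      fin_cases i
      · simp only [radial, Fin.zero_eta, Pi.smul_apply, cons_val_zero, smul_eq_mul]
        linear_combination Real.cos (Θ t) * e1 - Real.sin (Θ t) * e2 - x t 0 * hcs
      · simp only [radial, Fin.mk_one, Pi.smul_apply, cons_val_one, cons_val_fin_one, smul_eq_mul]
        linear_combination Real.sin (Θ t) * e1 + Real.cos (Θ t) * e2 - x t 1 * hcs
    have e : max t t₀ = t := max_eq_left ht
    have hr : r₀ * Real.exp (Λ t) ≠ 0 := by positivity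
    refine ⟨hxt, ?_, ?_⟩
    · simp only [hω, hX, hk, e]
      conv_lhs => rw [hxt]
      exact angularRate_smul_radial _ hr _
    · simp only [hη, hX, hk, e]
      conv_lhs => rw [hxt]
      exact radialRate_smul_radial _ hr _

end IsClosedLoopSolution

/-! ### The angle as independent variable, and exponential decay. -/

/-- A function whose derivative is bounded below by a positive constant has a differentiable
inverse. -/
lemma exists_hasDerivAt_inverse {Θ ω : ℝ → ℝ} (hΘ : ∀ t, HasDerivAt Θ (ω t) t) {m : ℝ}
    (hm : 0 < m) (hω : ∀ t, m ≤ ω t) :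
    ∃ τ : ℝ → ℝ, StrictMono τ ∧ (∀ t, τ (Θ t) = t) ∧ (∀ θ, Θ (τ θ) = θ) ∧
      ∀ θ, HasDerivAt τ (ω (τ θ))⁻¹ θ := by
  have hmono : StrictMono Θ := strictMono_of_deriv_pos fun t => by
    rw [(hΘ t).deriv]; exact hm.trans_le (hω t)
  have hdiff : Monotone fun t => Θ t - m * t := by
    have hd : ∀ t, HasDerivAt (fun t => Θ t - m * t) (ω t - m) t := fun t =>
      ((hΘ t).sub ((hasDerivAt_id t).const_mul m)).congr_deriv (by rw [mul_one])
    refine monotone_of_deriv_nonneg (fun t => (hd t).differentiableAt) fun t => ?_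
    rw [(hd t).deriv]; exact sub_nonneg.2 (hω t)
  have hsurj : Function.Surjective Θ := by
    refine Continuous.surjective (continuous_iff_continuousAt.2 fun t => (hΘ t).continuousAt) ?_ ?_
    · refine tendsto_atTop_mono' _ ?_
        (tendsto_atTop_add_const_left _ (Θ 0) (tendsto_id.const_mul_atTop hm))
      filter_upwards [eventually_ge_atTop 0] with t ht
      have := hdiff ht
      simp only [mul_zero, sub_zero, id] at this ⊢
      linarith
    · refine tendsto_atBot_mono' _ ?_
        (tendsto_atBot_add_const_left _ (Θ 0) (tendsto_id.const_mul_atBot hm))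
      filter_upwards [eventually_le_atBot 0] with t ht
      have := hdiff ht
      simp only [mul_zero, sub_zero, id] at this ⊢
      linarith
  set E := hmono.orderIsoOfSurjective Θ hsurj with hE
  have hr : ∀ θ, Θ (E.symm θ) = θ := fun θ => E.apply_symm_apply θ
  refine ⟨E.symm, E.symm.strictMono, fun t => E.symm_apply_apply t, hr, fun θ => ?_⟩
  exact HasDerivAt.of_local_left_inverse E.symm.continuous.continuousAt (hΘ _)
    (hm.trans_le (hω _)).ne' (Eventually.of_forall hr)

/-- A Lipschitz function that drops by `d` over each block of length `N π` starting at a positive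
multiple of `π` lies below a decreasing affine function. -/
lemma le_affine_of_drop {Λ : ℝ → ℝ} {F d θ₀ : ℝ} {N : ℕ} (hN : 0 < N) (hd : 0 ≤ d) (hF : 0 ≤ F)
    (hΛ : ∀ y z, |Λ y - Λ z| ≤ F * |y - z|) (hθ₀ : |θ₀| ≤ Real.pi) (h0 : Λ θ₀ = 0)
    (hdrop : ∀ j : ℕ, 1 ≤ j → Λ (N * Real.pi + j * Real.pi) ≤ Λ (j * Real.pi) - d) {y : ℝ}
    (hy : θ₀ ≤ y) :
    Λ y ≤ F * ((N + 2) * Real.pi) + 2 * d - d / (N * Real.pi) * y := by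
  have hπ := Real.pi_pos
  have hN1 : (1 : ℝ) ≤ N := by exact_mod_cast hN
  have hNπ : 0 < N * Real.pi := by positivity
  obtain ⟨hθ1, hθ2⟩ := abs_le.1 hθ₀
  have hup : ∀ y z, z ≤ y → Λ y ≤ Λ z + F * (y - z) := fun y z hyz => by
    have := (abs_le.1 (hΛ y z)).2
    rw [abs_of_nonneg (sub_nonneg.2 hyz)] at this
    linarith
  have hstart : ∀ y, θ₀ ≤ y → y ≤ Real.pi → Λ y ≤ F * (2 * Real.pi) := fun y h1 h2 => by
    have h3 := hup y θ₀ h1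
    have : F * (y - θ₀) ≤ F * (2 * Real.pi) := by gcongr; linarith
    linarith
  rcases le_total y Real.pi with hyπ | hyπ
  · have h1 := hstart y hy hyπ
    have h2 : d / (N * Real.pi) * y ≤ d := by
      rw [div_mul_eq_mul_div, div_le_iff₀ hNπ]
      have : y ≤ N * Real.pi := by nlinarith
      gcongr
    have h3 : F * (2 * Real.pi) ≤ F * ((N + 2) * Real.pi) := by gcongr; linarith
    linarith
  -- The number of complete blocks of length $N\pi$ between $\pi$ and $y$. Blocks start at $\pi$
  -- because the initial angle is at most $\pi$.
  · set n := ⌊(y - Real.pi) / (N * Real.pi)⌋₊ with hn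
    have hn1 : n * (N * Real.pi) ≤ y - Real.pi := by
      rw [← le_div_iff₀ hNπ]
      exact Nat.floor_le (div_nonneg (sub_nonneg.2 hyπ) hNπ.le)
    have hn2 : y - Real.pi < (n + 1) * (N * Real.pi) := by
      rw [← div_lt_iff₀ hNπ]
      exact Nat.lt_floor_add_one _
    have hiter : ∀ n : ℕ, Λ (Real.pi + n * (N * Real.pi)) ≤ Λ Real.pi - n * d := by
      intro n
      induction n with
      | zero => simp
      | succ n ih =>
        have h1 := hdrop (1 + n * N) (by omega)
        have e1 : N * Real.pi + ((1 + n * N : ℕ) : ℝ) * Real.pi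
            = Real.pi + ((n + 1 : ℕ) : ℝ) * (N * Real.pi) := by push_cast; ring
        have e2 : ((1 + n * N : ℕ) : ℝ) * Real.pi = Real.pi + n * (N * Real.pi) := by
          push_cast; ring
        rw [e1, e2] at h1
        push_cast at h1 ⊢
        linarith
    have h1 := hup y (Real.pi + n * (N * Real.pi)) (by linarith)
    have h2 := hiter n
    have h3 := hstart Real.pi hθ2 le_rfl
    have h4 : F * (y - (Real.pi + n * (N * Real.pi))) ≤ F * (N * Real.pi) := by
      gcongr; linarith
    have h5 : d / (N * Real.pi) * y ≤ (n + 2) * d := by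
      rw [div_mul_eq_mul_div, div_le_iff₀ hNπ]
      have : y ≤ (n + 2) * (N * Real.pi) := by nlinarith
      calc d * y ≤ d * ((n + 2) * (N * Real.pi)) := by gcongr
        _ = (n + 2) * d * (N * Real.pi) := by ring
    have h6 : F * ((N + 2) * Real.pi) = F * (2 * Real.pi) + F * (N * Real.pi) := by ring
    linarith

/-- Reparametrizing a solution in polar coordinates by the angle, shifted by a multiple of `π`. -/
lemma isAngularTrajectory_of_polar (hκ : IsAdmissibleGain δmin δmax κ) (ht₀ : 0 ≤ t₀)
    {Θ Λ ω η τ : ℝ → ℝ} (hωc : Continuous ω) (hηc : Continuous η) {m : ℝ} (hm : 0 < m)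
    (hω : ∀ t, m ≤ ω t) (hΛd : ∀ t, HasDerivAt Λ (η t) t)
    (hrate : ∀ t, t₀ ≤ t → ω t = g A b c (κ t) (Θ t) ∧ η t = h A b c (κ t) (Θ t))
    (hτm : StrictMono τ) (hτl : ∀ t, τ (Θ t) = t) (hτr : ∀ θ, Θ (τ θ) = θ)
    (hτd : ∀ θ, HasDerivAt τ (ω (τ θ))⁻¹ θ) {j : ℕ} (hj : Θ t₀ ≤ j * Real.pi) :
    IsAngularTrajectory A b c δmin δmax (fun θ => κ (τ (θ + j * Real.pi)))
      (fun θ => Real.exp (Λ (τ (θ + j * Real.pi)))) := by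
  have hτc : Continuous τ := continuous_iff_continuousAt.2 fun θ => (hτd θ).continuousAt
  have hΛc : Continuous Λ := continuous_iff_continuousAt.2 fun θ => (hΛd θ).continuousAt
  have hτC : ContDiff ℝ 1 τ := contDiff_one_iff_deriv.2
    ⟨fun θ => (hτd θ).differentiableAt, by
      rw [show deriv τ = fun θ => (ω (τ θ))⁻¹ from funext fun θ => (hτd θ).deriv]
      exact (hωc.comp hτc).inv₀ fun θ => (hm.trans_le (hω _)).ne'⟩
  have hΛC : ContDiff ℝ 1 Λ := contDiff_one_iff_deriv.2
    ⟨fun θ => (hΛd θ).differentiableAt, by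
      rw [show deriv Λ = η from funext fun θ => (hΛd θ).deriv]
      exact hηc⟩
  have hshift : ∀ θ, HasDerivAt (fun θ => τ (θ + j * Real.pi)) (ω (τ (θ + j * Real.pi)))⁻¹ θ :=
    fun θ => (hτd _).comp_add_const θ _
  have hle : ∀ θ, 0 ≤ θ → t₀ ≤ τ (θ + j * Real.pi) := fun θ hθ => by
    rw [← hτl t₀]; exact hτm.monotone (by linarith)
  have hlt : ∀ θ, 0 < θ → t₀ < τ (θ + j * Real.pi) := fun θ hθ => by
    rw [← hτl t₀]; exact hτm (by linarith)
  -- Periodicity removes the shift $j\pi$ from the rates, so every block is compared with the same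
  -- $\rho$ started at angle 0.
  have hrate' : ∀ θ, 0 ≤ θ →
      ω (τ (θ + j * Real.pi)) = g A b c (κ (τ (θ + j * Real.pi))) θ ∧
      η (τ (θ + j * Real.pi)) = h A b c (κ (τ (θ + j * Real.pi))) θ := fun θ hθ => by
    have := hrate _ (hle θ hθ)
    rwa [hτr, g_add_nat_mul_pi, h_add_nat_mul_pi] at this
  have hshiftC : ContDiff ℝ 1 fun θ => τ (θ + j * Real.pi) :=
    hτC.comp (contDiff_id.add contDiff_const)
  have hκd : ∀ t, 0 < t → HasDerivAt κ (derivWithin κ (Ici 0) t) t := fun t ht =>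
    ((hκ.contDiffOn.differentiableOn one_ne_zero t ht.le).hasDerivWithinAt).hasDerivAt
      (Ici_mem_nhds ht)
  refine ⟨?_, ?_, ?_, fun θ _ => Real.exp_pos _, ?_, ?_, ?_, ?_⟩
  · exact hκ.contDiffOn.continuousOn.comp hshiftC.continuous.continuousOn
      fun θ hθ => ht₀.trans (hle θ hθ)
  · exact (Real.continuous_exp.comp (hΛc.comp hshiftC.continuous)).continuousOn
  · exact fun θ hθ => hκ.mem_Icc _ (ht₀.trans (hle θ hθ))
  · exact hκ.contDiffOn.comp hshiftC.contDiffOn fun θ hθ => ht₀.trans (hle θ (le_of_lt hθ))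
  · exact (Real.contDiff_exp.comp (hΛC.comp hshiftC)).contDiffOn
  · intro θ hθ
    have hpos := ht₀.trans_lt (hlt θ hθ)
    have h1 := hκ.rate_mem _ hpos.le
    have h3 : HasDerivAt (fun θ => κ (τ (θ + j * Real.pi))) _ θ :=
      (hκd _ hpos).comp θ (hshift θ)
    rw [h3.deriv, (hrate' θ hθ.le).1, ← div_eq_mul_inv]
    have h2 : 0 < g A b c (κ (τ (θ + j * Real.pi))) θ := by
      rw [← (hrate' θ hθ.le).1]; exact hm.trans_le (hω _)
    exact ⟨div_le_div_of_nonneg_right h1.1 h2.le, div_le_div_of_nonneg_right h1.2 h2.le⟩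
  · intro θ hθ
    refine (((hΛd _).comp θ (hshift θ)).exp).congr_deriv ?_
    rw [(hrate' θ hθ.le).1, (hrate' θ hθ.le).2]
    simp only [f, Function.comp_apply]
    ring

/-- Uniform exponential decay of all closed-loop solutions under admissible gains. -/
theorem exists_exponential_decay (hδ : IsRateBound δmin δmax)
    (hosc : OscillatesCounterclockwise A b c)
    (hρ : IsViscositySolution A b c δmin δmax ρ)
    (hreg : HasLipschitzRegularity δmin δmax ρ)
    (hρ0 : ∀ k ∈ Icc (0 : ℝ) 1, ρ (k, 0) = 1)
    (hN : ∃ N : ℕ, ∀ k ∈ Icc (0 : ℝ) 1, ρ (k, N * Real.pi) < 1) :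
    ∃ C > 0, ∃ μ > 0, ∀ κ, IsAdmissibleGain δmin δmax κ → ∀ t₀, 0 ≤ t₀ → ∀ x,
      IsClosedLoopSolution A b c κ t₀ x → ∀ t, t₀ ≤ t →
        ‖x t‖ ≤ C * Real.exp (-μ * (t - t₀)) * ‖x t₀‖ := by
  obtain ⟨N, hN⟩ := hN
  have hNpos : 0 < N := by
    rcases Nat.eq_zero_or_pos N with rfl | hN0
    · have h1 := hN 0 (by simp)
      rw [Nat.cast_zero, zero_mul, hρ0 0 (by simp)] at h1
      exact absurd h1 (lt_irrefl _)
    · exact hN0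
  have hπ := Real.pi_pos
  have hNπ : 0 < N * Real.pi := by positivity
  -- The maximum with $1/2$ makes $q$ positive, so that its logarithm measures the drop.
  obtain ⟨q, hq0, hq1, hq⟩ : ∃ q > 0, q < 1 ∧ ∀ k ∈ Icc (0 : ℝ) 1, ρ (k, N * Real.pi) ≤ q := by
    obtain ⟨k₀, hk₀, hmax⟩ := isCompact_Icc.exists_isMaxOn (nonempty_Icc.2 zero_le_one)
      (hρ.continuousOn.comp (f := fun k : ℝ => (k, (N : ℝ) * Real.pi)) (s := Icc (0 : ℝ) 1)
        (by fun_prop) fun k hk => ⟨hk, hNπ.le⟩)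
    exact ⟨max (ρ (k₀, N * Real.pi)) (1 / 2), by positivity, max_lt (hN k₀ hk₀) (by norm_num),
      fun k hk => (hmax hk).trans (le_max_left _ _)⟩
  obtain ⟨m, hm, hg⟩ := exists_pos_le_g hosc
  obtain ⟨H, hH0, hH⟩ := exists_abs_h_le A b c
  set d := -Real.log q with hd
  have hd0 : 0 < d := neg_pos.2 (Real.log_neg hq0 hq1)
  set F := H / m with hF
  have hF0 : 0 < F := by positivity
  set C' := F * ((N + 2) * Real.pi) + 2 * d with hC'
  refine ⟨2 * Real.exp (C' + d / (N * Real.pi) * Real.pi), by positivity, d / (N * Real.pi) * m,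
    by positivity, fun κ hκ t₀ ht₀ x hx t ht => ?_⟩
  have hκ01 : ∀ t, t₀ ≤ t → κ t ∈ Icc (0 : ℝ) 1 := fun t ht => hκ.mem_Icc t (ht₀.trans ht)
  rcases eq_or_ne (x t₀) 0 with h0 | h0
  · rw [hx.eq_zero hκ01 h0 ht, h0]; simp
  obtain ⟨r₀, hr₀, hr₀le, Θ, Λ, ω, η, hωc, hηc, hΘd, hΛd, hω, hη, hΘ0, hΛ0, hpol⟩ :=
    hx.exists_polar_coordinates (hκ.contDiffOn.continuousOn.mono (Ici_subset_Ici.2 ht₀)) hκ01 h0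
      hg hH
  obtain ⟨τ, hτm, hτl, hτr, hτd⟩ := exists_hasDerivAt_inverse hΘd hm hω
  -- The angle grows at least at rate $m$ from a value no less than $-\pi$; this turns decay in the
  -- angle into decay in time.
  have hΘle : m * (t - t₀) - Real.pi ≤ Θ t := by
    have h1 := Convex.mul_sub_le_image_sub_of_le_deriv convex_univ
      (f := Θ) (C := m) (fun s _ => (hΘd s).continuousAt.continuousWithinAt)
      (fun s _ => (hΘd s).differentiableAt.differentiableWithinAt)
      (fun s _ => by rw [(hΘd s).deriv]; exact hω s) t₀ (mem_univ _) t (mem_univ _) ht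
    linarith [(abs_le.1 hΘ0).1]
  have hLip : ∀ y z, |Λ (τ y) - Λ (τ z)| ≤ F * |y - z| := by
    intro y z
    refine Convex.norm_image_sub_le_of_norm_hasDerivWithin_le (s := univ)
      (f := fun θ => Λ (τ θ)) (f' := fun θ => η (τ θ) * (ω (τ θ))⁻¹)
      (fun θ _ => ((hΛd _).comp θ (hτd θ)).hasDerivWithinAt) (fun θ _ => ?_) convex_univ
      (mem_univ z) (mem_univ y)
    rw [← div_eq_mul_inv, Real.norm_eq_abs, abs_div, abs_of_pos (hm.trans_le (hω _))]
    exact div_le_div₀ hH0.le (hη _) hm (hω _)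
  have hdrop : ∀ j : ℕ, 1 ≤ j →
      Λ (τ (N * Real.pi + j * Real.pi)) ≤ Λ (τ (j * Real.pi)) - d := by
    intro j hj
    have hj1 : (1 : ℝ) ≤ j := by exact_mod_cast hj
    have htraj := isAngularTrajectory_of_polar (A := A) (b := b) (c := c) hκ ht₀ hωc hηc hm hω hΛd
      (fun t ht => (hpol t ht).2) hτm hτl hτr hτd (j := j)
      ((abs_le.1 hΘ0).2.trans (le_mul_of_one_le_left hπ.le hj1))
    -- Reads $1/R(0)\le\rho/R(N\pi)\le q/R(N\pi)$; taking logarithms gives the drop $d=-\log q$.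
    have h1 := quotient_zero_le hδ hosc hρ hreg htraj hNπ.le
    rw [hρ0 _ (htraj.gain_mem 0 le_rfl)] at h1
    have h2 := hq _ (htraj.gain_mem _ hNπ.le)
    simp only [zero_add] at h1
    have h3 := h1.trans (div_le_div_of_nonneg_right h2 (Real.exp_pos _).le)
    rw [div_le_div_iff₀ (Real.exp_pos _) (Real.exp_pos _), one_mul, ← Real.exp_log hq0,
      ← Real.exp_add, Real.exp_le_exp] at h3
    linarith
  have hbound := le_affine_of_drop (Λ := fun θ => Λ (τ θ)) (θ₀ := Θ t₀) hNpos hd0.le hF0.le hLip hΘ0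
    (by simp only [hτl, hΛ0]) hdrop (y := Θ t)
    (hτm.le_iff_le.1 (by rw [hτl, hτl]; exact ht))
  simp only [hτl] at hbound
  have hΛle : Λ t ≤ (C' + d / (N * Real.pi) * Real.pi) + -(d / (N * Real.pi) * m) * (t - t₀) := by
    have := mul_le_mul_of_nonneg_left hΘle (show 0 ≤ d / (N * Real.pi) by positivity)
    linarith
  rw [(hpol t ht).1, norm_smul, Real.norm_eq_abs, abs_of_pos (by positivity)]
  calc r₀ * Real.exp (Λ t) * ‖radial (Θ t)‖
      ≤ 2 * ‖x t₀‖ * Real.exp ((C' + d / (N * Real.pi) * Real.pi)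
          + -(d / (N * Real.pi) * m) * (t - t₀)) * 1 := by
        gcongr
        exact norm_radial_le _
    _ = _ := by rw [Real.exp_add]; ring

end GainFeedback

end

theorem theorem1
    (A : Matrix (Fin 2) (Fin 2) ℝ) (b c : Fin 2 → ℝ)
    (δmin δmax : ℝ → ℝ) (hδ : GainFeedback.IsRateBound δmin δmax)
    (hosc : GainFeedback.OscillatesCounterclockwise A b c)
    (ρ : ℝ × ℝ → ℝ)
    (hρ : GainFeedback.IsViscositySolution A b c δmin δmax ρ)
    (hreg : GainFeedback.HasLipschitzRegularity δmin δmax ρ)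
    (hρ0 : ∀ k ∈ Set.Icc (0 : ℝ) 1, ρ (k, 0) = 1)
    (hN : ∃ N : ℕ, ∀ k ∈ Set.Icc (0 : ℝ) 1, ρ (k, N * Real.pi) < 1) :
    GainFeedback.IsAbsolutelyStable A b c δmin δmax := by
  obtain ⟨C, hC, μ, hμ, hdecay⟩ :=
    GainFeedback.exists_exponential_decay hδ hosc hρ hreg hρ0 hN
  refine fun κ hκ => ⟨fun t₀ ht₀ ε hε => ⟨ε / C, by positivity, fun x hx hx0 t ht => ?_⟩,
    fun t₀ ht₀ x hx => ?_⟩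
  · have h1 : Real.exp (-μ * (t - t₀)) ≤ 1 :=
      Real.exp_le_one_iff.2 (by nlinarith [mul_nonneg hμ.le (sub_nonneg.2 ht)])
    calc ‖x t‖ ≤ C * Real.exp (-μ * (t - t₀)) * ‖x t₀‖ := hdecay κ hκ t₀ ht₀ x hx t ht
      _ ≤ C * 1 * ‖x t₀‖ := by gcongr
      _ < ε := by rwa [mul_one, ← lt_div_iff₀' hC]
  · have hlim : Tendsto (fun t => C * Real.exp (-μ * (t - t₀)) * ‖x t₀‖) atTop (𝓝 0) := by
      have h1 : Tendsto (fun t => -μ * (t - t₀)) atTop atBot :=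
        (tendsto_atTop_add_const_right _ (-t₀) tendsto_id).const_mul_atTop_of_neg
          (neg_neg_of_pos hμ)
      simpa using ((Real.tendsto_exp_atBot.comp h1).const_mul C).mul_const ‖x t₀‖
    refine squeeze_zero_norm' ?_ hlim
    filter_upwards [eventually_ge_atTop t₀] with t ht using hdecay κ hκ t₀ ht₀ x hx t ht
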